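/- Let $n\ge 1$, let $\mathfrak{sl}_n=\mathfrak{sl}_n(\mathbb C)=\mathfrak n^+\oplus\mathfrak h\oplus\mathfrak n^-$ with the standard triangular decomposition, $\mathfrak b=\mathfrak n^+\oplus\mathfrak h$, let $R^+$ be the set of positive roots with $\mathfrak{sl}_2$-triples $(e_\alpha,h_\alpha,f_\alpha)$, let $P^+$ be the set of dominant integral weights, and let $A=\mathbb C[t]/(t^2)$. For $\lambda_1,\lambda_2\in P^+$ regard $\mathbb C_{\lambda_1+\lambda_2}$ as a $\mathfrak b\otimes\mathbb C[t]$-module through $\mathfrak b\otimes\mathbb C[t]\xrightarrow{t=0}\mathfrak b\to\mathfrak h\xrightarrow{\lambda_1+\lambda_2}\mathbb C$. Let $M_{\lambda_1,\lambda_2}$ be the quotient of the module induced from $\mathbb C_{\lambda_1+\lambda_2}$ to $(\mathfrak b\otimes 1)\oplus(\mathfrak{sl}_n\otimes t\mathbb C[t])$ by the submodule generated by $(\mathfrak n^-\otimes t^2\mathbb C[t]).\mathbb 1$ and the vectors $(f_\alpha\otimes t)^{\min\{\lambda_1(h_\alpha),\lambda_2(h_\alpha)\}+1}.\mathbb 1$,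 $\alpha\in R^+$, where $\mathbb 1$ is the canonical generator. Let $F_{\lambda_1,\lambda_2}$ be the maximal integrable (as an $\mathfrak{sl}_n$-module) quotient of the $\mathfrak{sl}_n\otimes\mathbb C[t]$-module induced from $M_{\lambda_1,\lambda_2}$. For $\lambda\in P^+$ let the graded local Weyl module $W_A(0,\lambda)$ be the $\mathfrak{sl}_n\otimes A$-module generated by $w$ with the relations $((\mathfrak n^+\oplus\mathfrak h)\otimes t).w=0$, $(h\otimes 1-\lambda(h)).w=0$ for $h\in\mathfrak h$, $(\mathfrak n^+\otimes 1).w=0$, and $(f_\alpha\otimes 1)^{\lambda(h_\alpha)+1}.w=0$ for $\alpha\in R^+$. Let $P(\lambda,2)$ be the set of unordered pairs $\{\lambda_1,\lambda_2\}$ of elements of $P^+$ with $\lambda_1+\lambda_2=\lambda$, ordered by $$\{\lambda_1,\lambda_2\}\preceq\{\mu_1,\mu_2\}\iff \min\{\lambda_1(h_\alpha),\lambda_2(h_\alpha)\}\le\min\{\mu_1(h_\alpha),\mu_2(h_\alpha)\}\ \text{ for all }\alpha\in R^+ .$$ **Lemma.** Let $\lambda\in P^+$. Then $P(\lambda,2)$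 has a unique maximal element $\{\lambda_1^{\max},\lambda_2^{\max}\}$. The action of $\mathfrak{sl}_n\otimes\mathbb C[t]$ on $F_{\lambda_1^{\max},\lambda_2^{\max}}$ factors through $\mathfrak{sl}_n\otimes A$, and there is an isomorphism of $\mathfrak{sl}_n\otimes A$-modules $$W_A(0,\lambda)\;\cong\;F_{\lambda_1^{\max},\lambda_2^{\max}},$$ which is also an isomorphism of $\mathfrak{sl}_n\otimes\mathbb C[t]$-modules, where $\mathfrak{sl}_n\otimes\mathbb C[t]$ acts on $W_A(0,\lambda)$ through the quotient map $\mathfrak{sl}_n\otimes\mathbb C[t]\to\mathfrak{sl}_n\otimes A$. -/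

import Mathlib

open scoped TensorProduct Polynomial

noncomputable section

namespace CurrentAlg

attribute [local instance 100] LieRing.ofAssociativeRing

/-! ### Universal enveloping algebras, induction, evaluation -/

/-- Abbreviation: the universal enveloping algebra of a complex Lie algebra. -/
abbrev U (L : Type*) [LieRing L] [LieAlgebra ℂ L] := UniversalEnvelopingAlgebra ℂ L

/-- The canonical map from a complex Lie algebra to its universal enveloping algebra. -/
abbrev toU {L : Type*} [LieRing L] [LieAlgebra ℂ L] (x : L) : U L :=
  UniversalEnvelopingAlgebra.ι ℂ x

/-- The algebra map `U(L) → U(L')` induced by a Lie algebra map `L → L'`. -/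
def uMap {L L' : Type*} [LieRing L] [LieAlgebra ℂ L] [LieRing L'] [LieAlgebra ℂ L']
    (f : L →ₗ⁅ℂ⁆ L') : U L →ₐ[ℂ] U L' :=
  UniversalEnvelopingAlgebra.lift ℂ ((UniversalEnvelopingAlgebra.ι ℂ).comp f)

/-- The relations `s f(r) ⊗ m - s ⊗ r m` that cut `S ⊗_R M` out of `S ⊗_ℤ M`. -/
def indRel {R S : Type*} [Ring R] [Ring S] (f : R →+* S)
    (M : Type*) [AddCommGroup M] [Module R M] : Submodule S (S ⊗[ℤ] M) :=
  Submodule.span S {z | ∃ (s : S) (r : R) (m : M), z = (s * f r) ⊗ₜ[ℤ] m - s ⊗ₜ[ℤ] (r • m)}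

/-- The induced left `S`-module `S ⊗_R M` along a ring homomorphism `f : R → S` of (not
necessarily commutative) rings. -/
abbrev Ind {R S : Type*} [Ring R] [Ring S] (f : R →+* S)
    (M : Type*) [AddCommGroup M] [Module R M] := (S ⊗[ℤ] M) ⧸ indRel f M

/-- The element `1 ⊗ m` of the induced module. -/
def indOne {R S : Type*} [Ring R] [Ring S] (f : R →+* S)
    {M : Type*} [AddCommGroup M] [Module R M] (m : M) : Ind f M :=
  (indRel f M).mkQ ((1 : S) ⊗ₜ[ℤ] m)

/-- Evaluation at `t = 0`, the Lie algebra map `L ⊗ ℂ[t] → L`. -/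
def evalZero (L : Type*) [LieRing L] [LieAlgebra ℂ L] : (ℂ[X] ⊗[ℂ] L) →ₗ⁅ℂ⁆ L where
  toLinearMap := (TensorProduct.lid ℂ L).toLinearMap ∘ₗ
    TensorProduct.map (Polynomial.aeval (0 : ℂ)).toLinearMap LinearMap.id
  map_lie' {x y} := by
    induction x using TensorProduct.induction_on with
    | zero => simp
    | add x x' hx hx' =>
      simp only [add_lie, map_add, AddHom.toFun_eq_coe, LinearMap.coe_toAddHom] at hx hx' ⊢
      rw [hx, hx']
    | tmul p a =>
      induction y using TensorProduct.induction_on with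
      | zero => simp
      | add y y' hy hy' =>
        simp only [lie_add, map_add, AddHom.toFun_eq_coe, LinearMap.coe_toAddHom] at hy hy' ⊢
        rw [hy, hy']
      | tmul q b =>
        simp [LieAlgebra.ExtendScalars.bracket_tmul, mul_smul]
        exact smul_comm _ _ _

@[simp]
theorem evalZero_tmul (L : Type*) [LieRing L] [LieAlgebra ℂ L] (p : ℂ[X]) (x : L) :
    evalZero L (p ⊗ₜ[ℂ] x) = p.eval 0 • x := by
  simp [evalZero, ← LieHom.coe_toLinearMap]

/-! ### The Lie algebra `sl_n` and its dominant integral weights -/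

/-- `sl_n(ℂ)`. -/
abbrev Sl (n : ℕ) := LieAlgebra.SpecialLinear.sl (Fin n) ℂ

/-- `h`: diagonal matrices of trace zero. -/
def cartan (n : ℕ) : Set (Sl n) := {x | ∀ i j, i ≠ j → x.val i j = 0}

/-- `n⁺`: strictly upper triangular matrices. -/
def nPlus (n : ℕ) : Set (Sl n) := {x | ∀ i j, j ≤ i → x.val i j = 0}

/-- `n⁻`: strictly lower triangular matrices. -/
def nMinus (n : ℕ) : Set (Sl n) := {x | ∀ i j, i ≤ j → x.val i j = 0}

/-- `b = n⁺ ⊕ h`: upper triangular matrices of trace zero. -/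
def borel (n : ℕ) : LieSubalgebra ℂ (Sl n) where
  carrier := {x | x.val.BlockTriangular id}
  add_mem' hx hy := Matrix.BlockTriangular.add hx hy
  zero_mem' := Matrix.blockTriangular_zero
  smul_mem' c x hx := fun i j hij => by
    have h : x.val i j = 0 := hx hij
    simp [h]
  lie_mem' {x y} hx hy := by
    change Matrix.BlockTriangular (x.val * y.val - y.val * x.val) id
    exact (Matrix.BlockTriangular.mul hx hy).sub (Matrix.BlockTriangular.mul hy hx)

/-- The positive roots of `sl_n` are `ε_i - ε_j` with `i < j`. For such a root, the root vectors
`e = E_{ij}`, `f = E_{ji}` and the coroot `h = E_{ii} - E_{jj}` form an `sl_2`-triple. -/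
def rootE {n : ℕ} {i j : Fin n} (hij : i < j) : Sl n :=
  LieAlgebra.SpecialLinear.single i j hij.ne 1

/-- See `rootE`. -/
def rootF {n : ℕ} {i j : Fin n} (hij : i < j) : Sl n :=
  LieAlgebra.SpecialLinear.single j i hij.ne' 1

/-- See `rootE`. -/
def coroot {n : ℕ} (i j : Fin n) : Sl n :=
  LieAlgebra.SpecialLinear.singleSubSingle i j 1

/-- Dominant integral weights of `sl_n`, written in the basis of fundamental weights:
`m` stands for `∑ k, m k • ω_k`, where `ω_k (diag a) = ∑_{i ≤ k} a i` (indices start at `0`). -/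
abbrev DomWeight (n : ℕ) := Fin (n - 1) → ℕ

/-- The dominant weight `lam` as a linear form. It is defined on `sl_n` by precomposing the form
on `h` with the projection to the diagonal, that is, it vanishes on `n⁺` and `n⁻`. -/
def wt {n : ℕ} (lam : DomWeight n) : Sl n →ₗ[ℂ] ℂ where
  toFun x := ∑ k, (lam k : ℂ) * ∑ i : Fin n with i.val ≤ k.val, x.val i i
  map_add' x y := by simp [Finset.sum_add_distrib, mul_add]
  map_smul' c x := by
    have h : ∀ i, (c • x).val i i = c * x.val i i := fun _ => rfl
    simp only [h, RingHom.id_apply, smul_eq_mul, Finset.mul_sum]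
    exact Finset.sum_congr rfl fun k _ => Finset.sum_congr rfl fun i _ => by ring

/-- The natural number `lam (h_α)` for the positive root `α = ε_i - ε_j = α_i + ⋯ + α_{j-1}`. -/
def pairing {n : ℕ} (lam : DomWeight n) (i j : Fin n) : ℕ :=
  ∑ k : Fin (n - 1) with i.val ≤ k.val ∧ k.val < j.val, lam k

theorem wt_coroot {n : ℕ} (lam : DomWeight n) {i j : Fin n} (hij : i < j) :
    wt lam (coroot i j) = pairing lam i j := by
  have key : ∀ (a : Fin n) (k : Fin (n - 1)),
      (∑ b : Fin n with b.val ≤ k.val, (Matrix.single a a (1 : ℂ)) b b)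
        = if a.val ≤ k.val then 1 else 0 := by
    intro a k
    simp [Matrix.single_apply, Finset.sum_ite_eq]
  have h : ∀ b, (coroot i j).val b b
      = (Matrix.single i i (1 : ℂ)) b b - (Matrix.single j j (1 : ℂ)) b b := fun _ => rfl
  simp only [wt, LinearMap.coe_mk, AddHom.coe_mk, h, Finset.sum_sub_distrib, key]
  rw [pairing, Nat.cast_sum, Finset.sum_filter]
  refine Finset.sum_congr rfl fun k _ => ?_
  have : i.val < j.val := hij
  split_ifs <;> first | omega | simp

/-! ### The modules `F` for the current algebra -/

/-- The current algebra `sl_n ⊗ ℂ[t]`. -/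
abbrev Cur (n : ℕ) := ℂ[X] ⊗[ℂ] Sl n

/-- `b ⊗ ℂ[t]`. -/
abbrev CurBorel (n : ℕ) := ℂ[X] ⊗[ℂ] borel n

/-- The subalgebra `(b ⊗ 1) ⊕ (sl_n ⊗ tℂ[t])` of the current algebra: the elements whose value
at `t = 0` lies in `b`. -/
def mid (n : ℕ) : LieSubalgebra ℂ (Cur n) := (borel n).comap (evalZero (Sl n))

/-- The inclusion `b ⊗ ℂ[t] → (b ⊗ 1) ⊕ (sl_n ⊗ tℂ[t])`. -/
def borelToMid (n : ℕ) : CurBorel n →ₗ⁅ℂ⁆ mid n where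
  toFun x := ⟨LieAlgebra.ExtendScalars.map (AlgHom.id ℂ ℂ[X]) (borel n).incl x, by
    change evalZero (Sl n) _ ∈ borel n
    induction x using TensorProduct.induction_on with
    | zero => simp
    | add x y hx hy => simp only [map_add]; exact add_mem hx hy
    | tmul p a => simpa using (borel n).smul_mem _ a.2⟩
  map_add' x y := by ext; simp
  map_smul' c x := by ext; simp
  map_lie' {x y} := by ext; simp

/-- The Lie algebra map `b ⊗ ℂ[t] → b → ℂ` given by evaluation at `t = 0` and `lam` (extended by
zero on `n⁺`). -/
def borelChar {n : ℕ} (lam : DomWeight n) : CurBorel n →ₗ⁅ℂ⁆ ℂ where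
  toLinearMap := wt lam ∘ₗ (borel n).incl.toLinearMap ∘ₗ (evalZero (borel n)).toLinearMap
  map_lie' {x y} := by
    have key : ∀ a b : Sl n, a ∈ borel n → b ∈ borel n → wt lam ⁅a, b⁆ = 0 := by
      intro a b ha hb
      have hd : ∀ a b : Sl n, a ∈ borel n → b ∈ borel n → ∀ i,
          (a.val * b.val) i i = a.val i i * b.val i i := by
        intro a b ha hb i
        rw [Matrix.mul_apply]
        refine Finset.sum_eq_single i (fun k _ hk => ?_) (by simp)
        rcases lt_or_gt_of_ne hk with h | h
        · have : a.val i k = 0 := ha h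
          simp [this]
        · have : b.val k i = 0 := hb h
          simp [this]
      change ∑ k, (lam k : ℂ) * ∑ i : Fin n with i.val ≤ k.val,
        (a.val * b.val - b.val * a.val) i i = 0
      refine Finset.sum_eq_zero fun k _ => ?_
      rw [Finset.sum_eq_zero, mul_zero]
      intro i _
      rw [Matrix.sub_apply, hd a b ha hb, hd b a hb ha, mul_comm, sub_self]
    have h := key (evalZero (borel n) x) (evalZero (borel n) y)
      (evalZero (borel n) x).2 (evalZero (borel n) y).2
    rw [LieRing.of_associative_ring_bracket, mul_comm, sub_self]
    simpa using h

/-- The one-dimensional `b ⊗ ℂ[t]`-module `ℂ_lam`. -/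
def OneDim {n : ℕ} (_lam : DomWeight n) : Type := ℂ

instance {n : ℕ} (lam : DomWeight n) : AddCommGroup (OneDim lam) :=
  inferInstanceAs (AddCommGroup ℂ)

instance {n : ℕ} (lam : DomWeight n) : Module (U (CurBorel n)) (OneDim lam) :=
  Module.compHom ℂ (UniversalEnvelopingAlgebra.lift ℂ (borelChar lam)).toRingHom

/-- The basis vector of `ℂ_lam`. -/
def oneDimGen {n : ℕ} (lam : DomWeight n) : OneDim lam := (1 : ℂ)

/-- The module `ℂ_lam` induced from `b ⊗ ℂ[t]` to `(b ⊗ 1) ⊕ (sl_n ⊗ tℂ[t])`. -/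
abbrev IndOneDim {n : ℕ} (lam : DomWeight n) :=
  Ind (uMap (borelToMid n)).toRingHom (OneDim lam)

/-- Its generator. -/
def indOneDimGen {n : ℕ} (lam : DomWeight n) : IndOneDim lam :=
  indOne (uMap (borelToMid n)).toRingHom (oneDimGen lam)

/-- The submodule generated by `(n⁻ ⊗ t²ℂ[t]) 1` and the
`(f_α ⊗ t) ^ (min (l₁ (h_α)) (l₂ (h_α)) + 1) 1` for all positive roots `α`. -/
def relM {n : ℕ} (l₁ l₂ : DomWeight n) : Submodule (U (mid n)) (IndOneDim (l₁ + l₂)) :=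
  Submodule.span (U (mid n))
    ({v | ∃ (y : mid n) (p : ℂ[X]), ∃ x ∈ nMinus n,
        y.val = (Polynomial.X ^ 2 * p) ⊗ₜ[ℂ] x ∧ v = toU y • indOneDimGen (l₁ + l₂)} ∪
     {v | ∃ (y : mid n) (i j : Fin n) (hij : i < j),
        y.val = (Polynomial.X : ℂ[X]) ⊗ₜ[ℂ] rootF hij ∧
        v = toU y ^ (min (pairing l₁ i j) (pairing l₂ i j) + 1) • indOneDimGen (l₁ + l₂)})

/-- The module `M_{l₁, l₂}` of `(b ⊗ 1) ⊕ (sl_n ⊗ tℂ[t])`. -/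
abbrev M {n : ℕ} (l₁ l₂ : DomWeight n) := IndOneDim (l₁ + l₂) ⧸ relM l₁ l₂

/-- `M_{l₁, l₂}` induced to the current algebra. -/
abbrev IndM {n : ℕ} (l₁ l₂ : DomWeight n) := Ind (uMap (mid n).incl).toRingHom (M l₁ l₂)

/-- An `sl_n ⊗ ℂ[t]`-module is integrable as an `sl_n`-module if it is the sum of its weight spaces
for `h` and all root vectors `e_α`, `f_α` act locally nilpotently (`sl_n` is `sl_n ⊗ 1`). -/
structure IsIntegrable (n : ℕ) (V : Type*) [AddCommGroup V] [Module (U (Cur n)) V] : Prop where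
  weights : AddSubgroup.closure {v : V | ∃ μ : Sl n →ₗ[ℂ] ℂ, ∀ h ∈ cartan n,
    toU ((1 : ℂ[X]) ⊗ₜ[ℂ] h : Cur n) • v = algebraMap ℂ (U (Cur n)) (μ h) • v} = ⊤
  nilpE : ∀ (i j : Fin n) (hij : i < j) (v : V), ∃ N : ℕ,
    toU ((1 : ℂ[X]) ⊗ₜ[ℂ] rootE hij : Cur n) ^ N • v = 0
  nilpF : ∀ (i j : Fin n) (hij : i < j) (v : V), ∃ N : ℕ,
    toU ((1 : ℂ[X]) ⊗ₜ[ℂ] rootF hij : Cur n) ^ N • v = 0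

/-- The intersection of all submodules with integrable quotient. -/
def intKer (n : ℕ) (V : Type*) [AddCommGroup V] [Module (U (Cur n)) V] :
    Submodule (U (Cur n)) V :=
  sInf {N | IsIntegrable n (V ⧸ N)}

/-- The `sl_n ⊗ ℂ[t]`-module `F_{l₁, l₂}`: the maximal integrable (as an `sl_n`-module) quotient of
the induced module of `M_{l₁, l₂}`. -/
abbrev F {n : ℕ} (l₁ l₂ : DomWeight n) := IndM l₁ l₂ ⧸ intKer n (IndM l₁ l₂)

/-! ### The graded local Weyl module for `A = ℂ[t]/(t²)` -/

/-- `A = ℂ[t]/(t²)`. -/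
abbrev A := ℂ[X] ⧸ Ideal.span {(Polynomial.X : ℂ[X]) ^ 2}

/-- The class of `t` in `A`. -/
def tA : A := Ideal.Quotient.mk _ Polynomial.X

/-- The truncated current algebra `sl_n ⊗ A`. -/
abbrev CurA (n : ℕ) := A ⊗[ℂ] Sl n

/-- The quotient map `sl_n ⊗ ℂ[t] → sl_n ⊗ A`. -/
def truncate (n : ℕ) : Cur n →ₗ⁅ℂ⁆ CurA n :=
  LieAlgebra.ExtendScalars.map (Ideal.Quotient.mkₐ ℂ _) LieHom.id

/-- The left ideal of the defining relations of the graded local Weyl module `W_A(0, lam)`. -/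
def weylRel {n : ℕ} (lam : DomWeight n) : Submodule (U (CurA n)) (U (CurA n)) :=
  Submodule.span (U (CurA n))
    ({u | ∃ x ∈ borel n, u = toU (tA ⊗ₜ[ℂ] x : CurA n)} ∪
     {u | ∃ h ∈ cartan n,
        u = toU ((1 : A) ⊗ₜ[ℂ] h : CurA n) - algebraMap ℂ (U (CurA n)) (wt lam h)} ∪
     {u | ∃ x ∈ nPlus n, u = toU ((1 : A) ⊗ₜ[ℂ] x : CurA n)} ∪
     {u | ∃ (i j : Fin n) (hij : i < j),
        u = toU ((1 : A) ⊗ₜ[ℂ] rootF hij : CurA n) ^ (pairing lam i j + 1)})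

/-- The graded local Weyl module `W_A(0, lam)`. -/
abbrev Weyl {n : ℕ} (lam : DomWeight n) := U (CurA n) ⧸ weylRel lam

/-! ### The poset `P(lam, 2)` -/

/-- The sum of an unordered pair of weights. -/
def pairSum {n : ℕ} : Sym2 (DomWeight n) → DomWeight n :=
  Sym2.lift ⟨fun a b => a + b, fun a b => add_comm a b⟩

/-- `min (l₁ (h_α)) (l₂ (h_α))` of an unordered pair, for `α = ε_i - ε_j`. -/
def pairMin {n : ℕ} (i j : Fin n) : Sym2 (DomWeight n) → ℕ :=
  Sym2.lift ⟨fun a b => min (pairing a i j) (pairing b i j), fun _ _ => min_comm _ _⟩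

/-- `P(lam, 2)`: unordered pairs of dominant integral weights adding up to `lam`. -/
structure Pairs {n : ℕ} (lam : DomWeight n) where
  /-- the unordered pair -/
  pair : Sym2 (DomWeight n)
  sum_eq : pairSum pair = lam

instance {n : ℕ} (lam : DomWeight n) : Preorder (Pairs lam) where
  le p q := ∀ i j : Fin n, i < j → pairMin i j p.pair ≤ pairMin i j q.pair
  le_refl _ _ _ _ := le_rfl
  le_trans _ _ _ h h' i j hij := (h i j hij).trans (h' i j hij)

end CurrentAlg

end

namespace CurrentAlg

/-! ### The maximal pair of weights -/

section Pairs

/-- The sum of the coefficients of a weight with index smaller than `k`. -/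
def psum {n : ℕ} (l : DomWeight n) (k : ℕ) : ℕ := ∑ i : Fin (n - 1) with i.val < k, l i

theorem psum_zero {n : ℕ} (l : DomWeight n) : psum l 0 = 0 := by simp [psum]

theorem psum_succ {n : ℕ} (l : DomWeight n) (k : Fin (n - 1)) :
    psum l (k.val + 1) = psum l k.val + l k := by
  have h : (Finset.univ.filter fun i : Fin (n - 1) => i.val < k.val + 1)
      = insert k (Finset.univ.filter fun i : Fin (n - 1) => i.val < k.val) := by
    ext i
    simp only [Finset.mem_filter, Finset.mem_univ, true_and, Finset.mem_insert, Fin.ext_iff]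
    omega
  rw [psum, h, Finset.sum_insert (by simp), psum, add_comm]

theorem psum_add {n : ℕ} (l l' : DomWeight n) (k : ℕ) :
    psum (l + l') k = psum l k + psum l' k := by
  simp [psum, Finset.sum_add_distrib]

theorem pairing_add {n : ℕ} (l l' : DomWeight n) (i j : Fin n) :
    pairing (l + l') i j = pairing l i j + pairing l' i j := by
  simp [pairing, Finset.sum_add_distrib]

theorem psum_add_pairing {n : ℕ} (l : DomWeight n) {i j : Fin n} (hij : i < j) :
    psum l i.val + pairing l i j = psum l j.val := by
  have hij' : i.val < j.val := hij
  rw [psum, pairing, psum, ← Finset.sum_union]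
  · refine Finset.sum_congr ?_ fun _ _ => rfl
    ext k
    simp only [Finset.mem_union, Finset.mem_filter, Finset.mem_univ, true_and]
    omega
  · rw [Finset.disjoint_left]
    intro k
    simp only [Finset.mem_filter, Finset.mem_univ, true_and]
    omega

theorem eq_of_psum_eq {n : ℕ} {l l' : DomWeight n} (h : ∀ k ≤ n - 1, psum l k = psum l' k) :
    l = l' := by
  funext k
  have h1 := h k.val k.2.le
  have h2 := h (k.val + 1) k.2
  rw [psum_succ, psum_succ] at h2
  omega

/-- The differences of a monotone function have its values as partial sums. -/
theorem psum_diff {n : ℕ} {g : ℕ → ℕ} (hg : Monotone g) (h0 : g 0 = 0) (k : ℕ) (hk : k ≤ n - 1) :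
    psum (fun i => g (i.val + 1) - g i.val : DomWeight n) k = g k := by
  induction k with
  | zero => rw [psum_zero, h0]
  | succ k ih =>
    have := psum_succ (fun i => g (i.val + 1) - g i.val : DomWeight n) ⟨k, hk⟩
    simp only at this
    rw [this, ih (by omega)]
    have := hg (Nat.le_succ k)
    simp only [Nat.succ_eq_add_one] at this
    omega

theorem psum_mono {n : ℕ} (l : DomWeight n) : Monotone (psum l) := by
  intro a b hab
  refine Finset.sum_le_sum_of_subset ?_
  intro i
  simp only [Finset.mem_filter, Finset.mem_univ, true_and]
  omega

/-- The larger half of a weight. -/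
def upperHalf {n : ℕ} (lam : DomWeight n) : DomWeight n :=
  fun i => (psum lam (i.val + 1) + 1) / 2 - (psum lam i.val + 1) / 2

/-- The smaller half of a weight. -/
def lowerHalf {n : ℕ} (lam : DomWeight n) : DomWeight n :=
  fun i => psum lam (i.val + 1) / 2 - psum lam i.val / 2

theorem psum_upperHalf {n : ℕ} (lam : DomWeight n) (k : ℕ) (hk : k ≤ n - 1) :
    psum (upperHalf lam) k = (psum lam k + 1) / 2 :=
  psum_diff (g := fun k => (psum lam k + 1) / 2)
    (fun a b hab => Nat.div_le_div_right (Nat.succ_le_succ (psum_mono lam hab)))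
    (by simp [psum_zero]) k hk

theorem psum_lowerHalf {n : ℕ} (lam : DomWeight n) (k : ℕ) (hk : k ≤ n - 1) :
    psum (lowerHalf lam) k = psum lam k / 2 :=
  psum_diff (g := fun k => psum lam k / 2)
    (fun a b hab => Nat.div_le_div_right (psum_mono lam hab))
    (by simp [psum_zero]) k hk

theorem upperHalf_add_lowerHalf {n : ℕ} (lam : DomWeight n) :
    upperHalf lam + lowerHalf lam = lam := by
  refine eq_of_psum_eq fun k hk => ?_
  rw [psum_add, psum_upperHalf lam k hk, psum_lowerHalf lam k hk]
  omega

/-- The pair of the two halves of a weight. -/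
def halves {n : ℕ} (lam : DomWeight n) : Pairs lam :=
  ⟨s(upperHalf lam, lowerHalf lam), upperHalf_add_lowerHalf lam⟩

theorem pairMin_halves {n : ℕ} (lam : DomWeight n) {i j : Fin n} (hij : i < j) :
    pairMin i j (halves lam).pair = pairing lam i j / 2 := by
  change min (pairing (upperHalf lam) i j) (pairing (lowerHalf lam) i j) = _
  have hi := i.2
  have hj := j.2
  have h1 := psum_add_pairing (upperHalf lam) hij
  have h2 := psum_add_pairing (lowerHalf lam) hij
  have h3 := psum_add_pairing lam hij
  rw [psum_upperHalf lam _ (by omega), psum_upperHalf lam _ (by omega)] at h1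
  rw [psum_lowerHalf lam _ (by omega), psum_lowerHalf lam _ (by omega)] at h2
  omega

theorem pairMin_le {n : ℕ} {lam : DomWeight n} (p : Pairs lam) (i j : Fin n) :
    pairMin i j p.pair ≤ pairing lam i j / 2 := by
  obtain ⟨p, hp⟩ := p
  induction p using Sym2.ind with
  | _ a b =>
    change a + b = lam at hp
    change min (pairing a i j) (pairing b i j) ≤ _
    rw [← hp, pairing_add]
    omega

theorem le_halves {n : ℕ} {lam : DomWeight n} (p : Pairs lam) : p ≤ halves lam :=
  fun i j hij => (pairMin_le p i j).trans (pairMin_halves lam hij).ge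

theorem pairMin_of_isMax {n : ℕ} {lam : DomWeight n} {p : Pairs lam} (hp : IsMax p)
    {i j : Fin n} (hij : i < j) : pairMin i j p.pair = pairing lam i j / 2 :=
  le_antisymm (pairMin_le p i j) ((pairMin_halves lam hij).ge.trans (hp (le_halves p) i j hij))

theorem eq_halves_of_psum_le {n : ℕ} {a b lam : DomWeight n} (hab : a + b = lam)
    (h : ∀ k ≤ n - 1, psum b k ≤ psum a k ∧ psum a k ≤ psum b k + 1) :
    a = upperHalf lam ∧ b = lowerHalf lam := by
  have key : ∀ k, psum a k + psum b k = psum lam k := fun k => by rw [← hab, psum_add]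
  constructor <;> refine eq_of_psum_eq fun k hk => ?_
  · rw [psum_upperHalf lam k hk]
    have := key k
    have := h k hk
    omega
  · rw [psum_lowerHalf lam k hk]
    have := key k
    have := h k hk
    omega

theorem eq_halves_of_isMax {n : ℕ} {lam : DomWeight n} {p : Pairs lam} (hp : IsMax p) :
    p = halves lam := by
  have hmin := fun (i j : Fin n) (hij : i < j) => pairMin_of_isMax hp hij
  obtain ⟨p, hsum⟩ := p
  induction p using Sym2.ind with
  | _ a b =>
    change a + b = lam at hsum
    have hd : ∀ i j : ℕ, i < j → j ≤ n - 1 →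
        psum a j + psum b i ≤ psum b j + psum a i + 1 ∧
        psum b j + psum a i ≤ psum a j + psum b i + 1 := by
      intro i j hij hj
      have hij' : (⟨i, by omega⟩ : Fin n) < ⟨j, by omega⟩ := hij
      have h := hmin _ _ hij'
      change min (pairing a _ _) (pairing b _ _) = _ at h
      rw [← hsum, pairing_add] at h
      have h1 := psum_add_pairing a hij'
      have h2 := psum_add_pairing b hij'
      simp only at h1 h2
      omega
    have ha := psum_zero a
    have hb := psum_zero b
    have hcase : (∀ k ≤ n - 1, psum b k ≤ psum a k ∧ psum a k ≤ psum b k + 1) ∨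
        (∀ k ≤ n - 1, psum a k ≤ psum b k ∧ psum b k ≤ psum a k + 1) := by
      by_contra! hcon
      obtain ⟨⟨k, hk, h1⟩, ⟨m, hm, h2⟩⟩ := hcon
      have e1 : psum a k < psum b k := by
        by_contra hlt
        have h3 := h1 (by omega)
        rcases Nat.eq_zero_or_pos k with rfl | hpos
        · omega
        · have := hd 0 k hpos hk
          omega
      have e2 : psum b m < psum a m := by
        by_contra hlt
        have h3 := h2 (by omega)
        rcases Nat.eq_zero_or_pos m with rfl | hpos
        · omega
        · have := hd 0 m hpos hm
          omega
      rcases lt_trichotomy k m with hkm | rfl | hkm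
      · have := hd k m hkm hm
        omega
      · omega
      · have := hd m k hkm hk
        omega
    rcases hcase with h | h
    · obtain ⟨rfl, rfl⟩ := eq_halves_of_psum_le hsum h
      rfl
    · obtain ⟨h1, h2⟩ := eq_halves_of_psum_le ((add_comm b a).trans hsum) h
      have h3 : s(a, b) = s(upperHalf lam, lowerHalf lam) := by rw [h1, h2, Sym2.eq_swap]
      unfold halves
      congr 1

theorem existsUnique_isMax {n : ℕ} (lam : DomWeight n) : ∃! p : Pairs lam, IsMax p :=
  ⟨halves lam, fun _ _ => le_halves _, fun _ hp => eq_halves_of_isMax hp⟩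

end Pairs

end CurrentAlg

noncomputable section
namespace CurrentAlg
attribute [local instance 100] LieRing.ofAssociativeRing

/-! ### Modules over enveloping algebras -/

section Enveloping

variable {L L' : Type*} [LieRing L] [LieAlgebra ℂ L] [LieRing L'] [LieAlgebra ℂ L']

@[simp]
theorem uMap_toU (f : L →ₗ⁅ℂ⁆ L') (x : L) : uMap f (toU x) = toU (f x) := by
  simp [uMap]

theorem toU_zero : toU (0 : L) = 0 := map_zero _

theorem toU_add (x y : L) : toU (x + y) = toU x + toU y := map_add _ _ _

theorem toU_neg (x : L) : toU (-x) = -toU x := map_neg _ _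

theorem toU_smul (c : ℂ) (x : L) : toU (c • x) = c • toU x := map_smul _ _ _

theorem toU_lie (x y : L) : toU ⁅x, y⁆ = toU x * toU y - toU y * toU x := by
  rw [toU, LieHom.map_lie, LieRing.of_associative_ring_bracket]

theorem toU_mul_toU (x y : L) : toU x * toU y = toU y * toU x + toU ⁅x, y⁆ := by
  rw [toU_lie]; abel

theorem adjoin_range_toU : Algebra.adjoin ℂ (Set.range (toU : L → U L)) = ⊤ := by
  set S := Algebra.adjoin ℂ (Set.range (toU : L → U L)) with hS
  let j : L →ₗ⁅ℂ⁆ S :=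
    { toFun := fun x => ⟨toU x, Algebra.subset_adjoin ⟨x, rfl⟩⟩
      map_add' := fun x y => Subtype.ext (by simp)
      map_smul' := fun c x => Subtype.ext (by simp)
      map_lie' := fun {x y} => Subtype.ext (toU_lie x y) }
  have h : S.val.comp (UniversalEnvelopingAlgebra.lift ℂ j) = AlgHom.id ℂ (U L) := by
    ext x
    simp [j]
  rw [eq_top_iff]
  intro u _
  have hu : S.val (UniversalEnvelopingAlgebra.lift ℂ j u) = u := DFunLike.congr_fun h u
  rw [← hu]
  exact Subtype.property _

/-- An additive subgroup of a module over `U L` is stable under `U L` if it is stable under scalars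
and under `L`. -/
theorem smul_mem_of_toU_smul_mem {V : Type*} [AddCommGroup V] [Module (U L) V] (S : AddSubgroup V)
    (hc : ∀ (c : ℂ), ∀ v ∈ S, algebraMap ℂ (U L) c • v ∈ S)
    (hL : ∀ (x : L), ∀ v ∈ S, toU x • v ∈ S) (u : U L) : ∀ v ∈ S, u • v ∈ S := by
  have hu : u ∈ Algebra.adjoin ℂ (Set.range (toU : L → U L)) := by
    rw [adjoin_range_toU]; trivial
  induction hu using Algebra.adjoin_induction with
  | mem x hx => obtain ⟨x, rfl⟩ := hx; exact hL x
  | algebraMap c => exact hc c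
  | add a b _ _ ha hb => intro v hv; rw [add_smul]; exact S.add_mem (ha v hv) (hb v hv)
  | mul a b _ _ ha hb => intro v hv; rw [mul_smul]; exact ha _ (hb v hv)

theorem algebraMap_smul_comm {V : Type*} [AddCommGroup V] [Module (U L) V] (c : ℂ) (u : U L)
    (v : V) : u • algebraMap ℂ (U L) c • v = algebraMap ℂ (U L) c • u • v := by
  rw [← mul_smul, ← mul_smul, Algebra.commutes]

theorem eq_top_of_generator {V : Type*} [AddCommGroup V] [Module (U L) V] {g : V}
    (hg : Submodule.span (U L) {g} = ⊤) (S : AddSubgroup V) (h0 : g ∈ S)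
    (hc : ∀ (c : ℂ), ∀ v ∈ S, algebraMap ℂ (U L) c • v ∈ S)
    (hL : ∀ (x : L), ∀ v ∈ S, toU x • v ∈ S) : S = ⊤ := by
  rw [eq_top_iff]
  intro v _
  have hv : v ∈ Submodule.span (U L) {g} := by rw [hg]; trivial
  obtain ⟨u, rfl⟩ := Submodule.mem_span_singleton.1 hv
  exact smul_mem_of_toU_smul_mem S hc hL u g h0

/-- An `ad`-nilpotent element that is nilpotent at a vector is nilpotent at its translates. -/
theorem pow_smul_toU_smul {V : Type*} [AddCommGroup V] [Module (U L) V] (x : L) :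
    ∀ (k N : ℕ) (y : L) (v : V), (LieAlgebra.ad ℂ L x ^ k) y = 0 → toU x ^ N • v = 0 →
      toU x ^ (k + N) • toU y • v = 0 := by
  intro k
  induction k with
  | zero =>
    intro N y v hy _
    have hy : y = 0 := by simpa using hy
    simp [hy]
  | succ k ihk =>
    intro N
    induction N with
    | zero =>
      intro y v _ hv
      have hv : v = 0 := by simpa using hv
      simp [hv]
    | succ N ihN =>
      intro y v hy hv
      have h1 : toU x ^ (k + 1 + N) • toU y • toU x • v = 0 :=
        ihN y _ hy (by rw [← mul_smul, ← pow_succ]; exact hv)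
      have h2 : toU x ^ (k + (N + 1)) • toU ⁅x, y⁆ • v = 0 :=
        ihk (N + 1) _ v (by rw [pow_succ, Module.End.mul_apply] at hy; exact hy) hv
      rw [show k + 1 + (N + 1) = k + 1 + N + 1 by ring, pow_succ, mul_smul, ← mul_smul (toU x),
        toU_mul_toU, add_smul, smul_add, mul_smul, h1, zero_add,
        show k + 1 + N = k + (N + 1) by ring, h2]

/-- An `ad`-nilpotent element that is nilpotent at a generator is locally nilpotent. -/
theorem exists_pow_smul_eq_zero {V : Type*} [AddCommGroup V] [Module (U L) V] {g : V}
    (hg : Submodule.span (U L) {g} = ⊤) (x : L) {k : ℕ} (hx : LieAlgebra.ad ℂ L x ^ k = 0)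
    (h : ∃ N : ℕ, toU x ^ N • g = 0) (v : V) : ∃ N : ℕ, toU x ^ N • v = 0 := by
  let S : AddSubgroup V :=
    { carrier := {v | ∃ N : ℕ, toU x ^ N • v = 0}
      zero_mem' := ⟨0, by simp⟩
      add_mem' := by
        rintro a b ⟨N, hN⟩ ⟨N', hN'⟩
        refine ⟨N + N', ?_⟩
        rw [smul_add, pow_add, mul_smul _ _ b, hN', smul_zero, add_zero, ← pow_add, add_comm,
          pow_add, mul_smul, hN, smul_zero]
      neg_mem' := by
        rintro a ⟨N, hN⟩
        exact ⟨N, by rw [smul_neg, hN, neg_zero]⟩ }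
  have hS : S = ⊤ := by
    refine eq_top_of_generator hg S h ?_ ?_
    · rintro c v ⟨N, hN⟩
      exact ⟨N, by rw [algebraMap_smul_comm, hN, smul_zero]⟩
    · rintro y v ⟨N, hN⟩
      exact ⟨k + N, pow_smul_toU_smul x k N y v (by rw [hx]; rfl) hN⟩
  have hv : v ∈ S := by rw [hS]; trivial
  exact hv

/-- If an ideal kills a generator, it kills the module. -/
theorem toU_smul_eq_zero_of_generator {V : Type*} [AddCommGroup V] [Module (U L) V] {g : V}
    (hg : Submodule.span (U L) {g} = ⊤) (f : L →ₗ⁅ℂ⁆ L')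
    (h : ∀ x, f x = 0 → toU x • g = 0) (v : V) : ∀ x, f x = 0 → toU x • v = 0 := by
  let S : AddSubgroup V :=
    { carrier := {v | ∀ x, f x = 0 → toU x • v = 0}
      zero_mem' := fun x _ => smul_zero _
      add_mem' := fun {a b} ha hb x hx => by rw [smul_add, ha x hx, hb x hx, add_zero]
      neg_mem' := fun {a} ha x hx => by rw [smul_neg, ha x hx, neg_zero] }
  have hS : S = ⊤ := by
    refine eq_top_of_generator hg S h ?_ ?_
    · intro c v hv x hx
      rw [algebraMap_smul_comm, hv x hx, smul_zero]
    · intro y v hv x hx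
      rw [← mul_smul, toU_mul_toU, add_smul, mul_smul, hv x hx, smul_zero, zero_add]
      exact hv _ (by rw [LieHom.map_lie, hx, zero_lie])
  have hv : v ∈ S := by rw [hS]; trivial
  exact hv

/-- A module on which the kernel of a surjective Lie algebra map acts by zero is a module over
the enveloping algebra of the target. -/
theorem exists_module_of_surjective {V : Type*} [AddCommGroup V] [Module (U L) V]
    (f : L →ₗ⁅ℂ⁆ L') (hf : Function.Surjective f)
    (h : ∀ x, f x = 0 → ∀ v : V, toU x • v = 0) :
    ∃ _inst : Module (U L') V, ∀ (u : U L) (v : V), uMap f u • v = u • v := by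
  let _ : Module ℂ V := Module.compHom V (algebraMap ℂ (U L))
  have : IsScalarTower ℂ (U L) V := ⟨fun c u v => by
    rw [Algebra.smul_def, mul_smul]; rfl⟩
  let ρ : U L →ₐ[ℂ] Module.End ℂ V := Algebra.lsmul ℂ ℂ V
  have hρ : ∀ x y, f x = f y → ρ (toU x) = ρ (toU y) := by
    intro x y hxy
    have h0 : f (x - y) = 0 := by rw [map_sub, hxy, sub_self]
    ext v
    have := h _ h0 v
    rw [toU, map_sub, sub_smul, sub_eq_zero] at this
    exact this
  choose s hs using hf
  let φ : L' →ₗ⁅ℂ⁆ Module.End ℂ V :=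
    { toFun := fun x => ρ (toU (s x))
      map_add' := fun x y => by
        rw [← map_add, ← map_add]
        exact hρ _ _ (by rw [hs, map_add, hs, hs])
      map_smul' := fun c x => by
        rw [RingHom.id_apply, ← map_smul, ← map_smul]
        exact hρ _ _ (by rw [hs, map_smul, hs])
      map_lie' := fun {x y} => by
        rw [LieRing.of_associative_ring_bracket, ← map_mul ρ, ← map_mul ρ, ← map_sub ρ,
          ← toU_lie]
        exact hρ _ _ (by rw [hs, LieHom.map_lie, hs, hs]) }
  let Ψ : U L' →ₐ[ℂ] Module.End ℂ V := UniversalEnvelopingAlgebra.lift ℂ φ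
  have hΨ : Ψ.comp (uMap f) = ρ := by
    ext x : 2
    change Ψ (uMap f (toU x)) = ρ (toU x)
    rw [uMap_toU]
    change UniversalEnvelopingAlgebra.lift ℂ φ (UniversalEnvelopingAlgebra.ι ℂ (f x)) = _
    rw [UniversalEnvelopingAlgebra.lift_ι_apply]
    exact hρ _ _ (hs _)
  refine ⟨Module.compHom V Ψ.toRingHom, fun u v => ?_⟩
  change Ψ.comp (uMap f) u v = u • v
  rw [hΨ]
  rfl

end Enveloping

/-! ### Induced modules -/

theorem span_mkQ_eq_top {R V : Type*} [Ring R] [AddCommGroup V] [Module R V] {g : V}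
    (hg : Submodule.span R {g} = ⊤) (N : Submodule R V) : Submodule.span R {N.mkQ g} = ⊤ := by
  rw [← Set.image_singleton, ← Submodule.map_span, hg, Submodule.map_top, Submodule.range_mkQ]

section Induction

variable {R S T : Type*} [Ring R] [Ring S] [Ring T] (f : R →+* S) (σ : S →+* T)
  {M W : Type*} [AddCommGroup M] [Module R M] [AddCommGroup W] [Module T W]

theorem indOne_smul (r : R) (m : M) : indOne f (r • m) = f r • indOne f m := by
  rw [indOne, indOne, ← map_smul, ← sub_eq_zero, ← map_sub, ← neg_eq_zero, ← map_neg, neg_sub,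
    Submodule.mkQ_apply, Submodule.Quotient.mk_eq_zero]
  refine Submodule.subset_span ⟨1, r, m, ?_⟩
  rw [TensorProduct.smul_tmul', smul_eq_mul, mul_one, one_mul]

theorem indOne_zero : indOne f (0 : M) = 0 := by
  rw [indOne, TensorProduct.tmul_zero, map_zero]

theorem span_indOne {g : M} (hg : Submodule.span R {g} = ⊤) :
    Submodule.span S {indOne f g} = ⊤ := by
  rw [eq_top_iff]
  rintro z -
  obtain ⟨z, rfl⟩ := Submodule.mkQ_surjective _ z
  induction z using TensorProduct.induction_on with
  | zero => simp
  | add x y hx hy => rw [map_add]; exact Submodule.add_mem _ hx hy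
  | tmul s m =>
    have hm : m ∈ Submodule.span R {g} := by rw [hg]; trivial
    obtain ⟨r, rfl⟩ := Submodule.mem_span_singleton.1 hm
    have : s ⊗ₜ[ℤ] (r • g) = s • ((1 : S) ⊗ₜ[ℤ] (r • g)) := by
      rw [TensorProduct.smul_tmul', smul_eq_mul, mul_one]
    rw [this, map_smul]
    change s • indOne f (r • g) ∈ _
    rw [indOne_smul]
    exact Submodule.smul_mem _ _ (Submodule.smul_mem _ _ (Submodule.mem_span_singleton_self _))

/-- The universal property of the induced module, with values in a module over an extension. -/
theorem exists_indLift (φ : M →ₛₗ[σ.comp f] W) :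
    ∃ Φ : Ind f M →ₛₗ[σ] W, ∀ m, Φ (indOne f m) = φ m := by
  let β : S ⊗[ℤ] M →+ W := TensorProduct.liftAddHom
    { toFun := fun s =>
        { toFun := fun m => σ s • φ m
          map_zero' := by simp
          map_add' := fun m m' => by simp }
      map_zero' := by ext; simp
      map_add' := fun s s' => by ext; simp [add_smul] }
    (fun z s m => by
      change σ (z • s) • φ m = σ s • φ (z • m)
      rw [map_zsmul, map_zsmul, smul_assoc, smul_comm])
  have hβ : ∀ s m, β (s ⊗ₜ m) = σ s • φ m := fun s m => rfl
  let γ : S ⊗[ℤ] M →ₛₗ[σ] W :=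
    { toFun := β
      map_add' := map_add β
      map_smul' := fun s z => by
        induction z using TensorProduct.induction_on with
        | zero => simp
        | add x y hx hy => rw [smul_add, map_add, hx, hy, map_add, smul_add]
        | tmul s' m =>
          rw [TensorProduct.smul_tmul', hβ, hβ, smul_eq_mul, map_mul, mul_smul] }
  have hγ : ∀ s m, γ (s ⊗ₜ m) = σ s • φ m := hβ
  refine ⟨(indRel f M).liftQ γ ?_, fun m => ?_⟩
  · rw [indRel, Submodule.span_le]
    rintro _ ⟨s, r, m, rfl⟩
    change γ _ = 0
    rw [map_sub, hγ, hγ, LinearMap.map_smulₛₗ, map_mul, mul_smul, RingHom.comp_apply, sub_self]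
  · change γ (1 ⊗ₜ m) = φ m
    rw [hγ, map_one, one_smul]

/-- The universal property of the module induced from a quotient. -/
theorem exists_indLift_quotient (N : Submodule R M) (φ : M →ₛₗ[σ.comp f] W)
    (hφ : N ≤ LinearMap.ker φ) :
    ∃ Φ : Ind f (M ⧸ N) →ₛₗ[σ] W, ∀ m, Φ (indOne f (N.mkQ m)) = φ m := by
  obtain ⟨Φ, hΦ⟩ := exists_indLift f σ (N.liftQ φ hφ)
  exact ⟨Φ, fun m => hΦ _⟩

end Induction

/-! ### Computations with `sl_2`-triples -/

section SlTwo

variable {S V : Type*} [Ring S] [Algebra ℂ S] [AddCommGroup V] [Module S V] [Module ℂ V]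
  [IsScalarTower ℂ S V]

theorem sl2_smul_pow {e f h : S} (hef : e * f = f * e + h) (hhf : h * f = f * h - (2 : ℂ) • f)
    {v : V} {c : ℂ} (he : e • v = 0) (hh : h • v = c • v) (k : ℕ) :
    h • f ^ k • v = (c - 2 * k) • f ^ k • v ∧
      e • f ^ (k + 1) • v = ((k + 1) * (c - k)) • f ^ k • v := by
  have step : ∀ k : ℕ, f ^ (k + 1) • v = f • f ^ k • v := fun k => by rw [pow_succ', mul_smul]
  have H : ∀ k : ℕ, h • f ^ k • v = (c - 2 * k) • f ^ k • v := by
    intro k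
    induction k with
    | zero => simp [hh]
    | succ k ih =>
      rw [step, ← mul_smul, hhf, sub_smul, mul_smul, ih, smul_assoc, smul_comm f, ← sub_smul]
      push_cast
      ring_nf
  refine ⟨H k, ?_⟩
  induction k with
  | zero => rw [step, ← mul_smul, hef, add_smul, mul_smul]; simp [he, hh]
  | succ k ih =>
    rw [step, ← mul_smul, hef, add_smul, mul_smul, ih, H, smul_comm f, ← step, ← add_smul]
    push_cast
    ring_nf

/-- If `f` is nilpotent at a highest weight vector of weight `m`, then `f ^ (m + 1)` kills it. -/
theorem sl2_pow_smul_eq_zero {e f h : S} (hef : e * f = f * e + h)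
    (hhf : h * f = f * h - (2 : ℂ) • f) {v : V} {m : ℕ} (he : e • v = 0)
    (hh : h • v = (m : ℂ) • v) (hf : ∃ N : ℕ, f ^ N • v = 0) : f ^ (m + 1) • v = 0 := by
  classical
  have hmin := fun {k : ℕ} => Nat.find_min hf (m := k)
  have hN := Nat.find_spec hf
  set N := Nat.find hf
  clear_value N
  rcases N with _ | k
  · have hv : v = 0 := by simpa using hN
    rw [hv, smul_zero]
  · have h1 := (sl2_smul_pow hef hhf he hh k).2
    rw [hN, smul_zero, eq_comm, smul_eq_zero] at h1
    have h2 : ((k : ℂ) + 1) * (m - k) = 0 := h1.resolve_right (hmin (Nat.lt_succ_self k))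
    have h3 : (m : ℂ) - k = 0 :=
      (mul_eq_zero.1 h2).resolve_left (by exact_mod_cast Nat.succ_ne_zero k)
    have h4 : m = k := by exact_mod_cast sub_eq_zero.1 h3
    rw [h4, hN]

/-- In the truncated current algebra of `sl_2`, moving `e ⊗ t` through powers of `f` trades two
factors `f` for one factor `f ⊗ t`. -/
theorem truncated_smul_pow {e f h g : S} (hef : e * f = f * e + h)
    (hhf : h * f = f * h - (2 : ℂ) • g) (hgf : g * f = f * g)
    {v : V} (he : e • v = 0) (hh : h • v = 0) (k : ℕ) :
    e • f ^ (k + 2) • v = -(((k : ℂ) + 2) * (k + 1)) • g • f ^ k • v := by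
  have step : ∀ k : ℕ, f ^ (k + 1) • v = f • f ^ k • v := fun k => by rw [pow_succ', mul_smul]
  have hgf' : ∀ w : V, f • g • w = g • f • w := fun w => by rw [← mul_smul, ← hgf, mul_smul]
  have H : ∀ k : ℕ, h • f ^ (k + 1) • v = (-(2 * ((k : ℂ) + 1))) • g • f ^ k • v := by
    intro k
    induction k with
    | zero => rw [step, ← mul_smul, hhf, sub_smul, mul_smul, smul_assoc]; simp [hh]
    | succ k ih =>
      rw [step, ← mul_smul, hhf, sub_smul, mul_smul, ih, smul_assoc, smul_comm f, hgf', ← step,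
        ← sub_smul]
      push_cast
      ring_nf
  have H1 : e • f • v = 0 := by rw [← mul_smul, hef, add_smul, mul_smul, he, hh]; simp
  induction k with
  | zero =>
    rw [step, ← mul_smul, hef, add_smul, mul_smul, H]
    simp [H1]
  | succ k ih =>
    rw [step, ← mul_smul, hef, add_smul, mul_smul, ih, H, smul_comm f, hgf', ← step, ← add_smul]
    push_cast
    ring_nf

theorem truncated_pow_smul_eq_zero {e f h g : S} (hef : e * f = f * e + h)
    (hhf : h * f = f * h - (2 : ℂ) • g) (hgf : g * f = f * g) (heg : e * g = g * e)
    {v : V} (he : e • v = 0) (hh : h • v = 0) {k : ℕ} (hk : f ^ (2 * k) • v = 0) :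
    g ^ k • v = 0 := by
  have key : ∀ k j : ℕ, g ^ j • f ^ (2 * k) • v = 0 → g ^ (j + k) • v = 0 := by
    intro k
    induction k with
    | zero => intro j hj; simpa using hj
    | succ k ih =>
      intro j hj
      have h1 : e • g ^ j • f ^ (2 * k + 2) • v = 0 := by
        rw [show 2 * k + 2 = 2 * (k + 1) by ring, hj, smul_zero]
      have heg' : e * g ^ j = g ^ j * e := (Commute.pow_right heg j)
      rw [← mul_smul, heg', mul_smul, truncated_smul_pow hef hhf hgf he hh, smul_comm (g ^ j),
        ← mul_smul (g ^ j), ← pow_succ, smul_eq_zero, neg_eq_zero] at h1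
      have h2 := ih (j + 1) (h1.resolve_left (by
        exact_mod_cast (mul_pos (Nat.succ_pos (2 * k + 1)) (Nat.succ_pos (2 * k))).ne'))
      rwa [show j + (k + 1) = j + 1 + k by ring]
  simpa using key k 0 (by simpa using hk)

end SlTwo

/-! ### Root vectors -/

section Roots

variable {n : ℕ}

theorem lie_rootE_rootF {i j : Fin n} (hij : i < j) : ⁅rootE hij, rootF hij⁆ = coroot i j := by
  apply Subtype.ext
  rw [LieAlgebra.SpecialLinear.sl_bracket]
  simp [rootE, rootF, coroot]

theorem lie_coroot_rootF {i j : Fin n} (hij : i < j) :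
    ⁅coroot i j, rootF hij⁆ = -((2 : ℂ) • rootF hij) := by
  apply Subtype.ext
  rw [LieAlgebra.SpecialLinear.sl_bracket]
  simp [rootF, coroot, sub_mul, mul_sub, Matrix.single_mul_single_of_ne, hij.ne, two_smul]
  abel

theorem rootE_mem_nPlus {i j : Fin n} (hij : i < j) : rootE hij ∈ nPlus n := by
  intro a b hab
  change Matrix.single i j (1 : ℂ) a b = 0
  rw [Matrix.single_apply, if_neg]
  rintro ⟨rfl, rfl⟩
  exact absurd hij hab.not_gt

theorem coroot_mem_cartan (i j : Fin n) : coroot i j ∈ cartan n := by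
  intro a b hab
  change (Matrix.single i i (1 : ℂ) - Matrix.single j j (1 : ℂ)) a b = 0
  rw [Matrix.sub_apply, Matrix.single_apply, Matrix.single_apply, if_neg, if_neg, sub_zero] <;>
  · rintro ⟨rfl, rfl⟩
    exact hab rfl

theorem nPlus_subset_borel {x : Sl n} (hx : x ∈ nPlus n) : x ∈ borel n :=
  fun i j hij => hx i j (le_of_lt hij)

theorem cartan_subset_borel {x : Sl n} (hx : x ∈ cartan n) : x ∈ borel n :=
  fun i j hij => hx i j (ne_of_gt hij)

theorem wt_of_mem_nPlus (lam : DomWeight n) {x : Sl n} (hx : x ∈ nPlus n) : wt lam x = 0 := by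
  change ∑ k, (lam k : ℂ) * ∑ i : Fin n with i.val ≤ k.val, x.val i i = 0
  refine Finset.sum_eq_zero fun k _ => ?_
  rw [Finset.sum_eq_zero fun i _ => hx i i le_rfl, mul_zero]

/-- The diagonal part of a matrix of trace zero. -/
def diagPart (x : Sl n) : Sl n :=
  ⟨Matrix.diagonal fun i => x.val i i, by
    have h : x.val.trace = 0 := x.2
    change (Matrix.diagonal fun i => x.val i i).trace = 0
    rwa [Matrix.trace_diagonal]⟩

theorem diagPart_mem_cartan (x : Sl n) : diagPart x ∈ cartan n :=
  fun _ _ hij => Matrix.diagonal_apply_ne _ hij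

/-- The strictly upper triangular part of a matrix. -/
def upperPart (x : Sl n) : Sl n :=
  ⟨Matrix.of fun i j => if i < j then x.val i j else 0, by
    change (Matrix.of fun i j : Fin n => if i < j then x.val i j else 0).trace = 0
    simp [Matrix.trace]⟩

theorem upperPart_mem_nPlus (x : Sl n) : upperPart x ∈ nPlus n :=
  fun _ _ hij => if_neg hij.not_gt

theorem eq_diagPart_add_upperPart {x : Sl n} (hx : x ∈ borel n) :
    x = diagPart x + upperPart x := by
  apply Subtype.ext
  ext i j
  change x.val i j = Matrix.diagonal (fun i => x.val i i) i j + if i < j then x.val i j else 0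
  rcases lt_trichotomy i j with h | rfl | h
  · simp [h, h.ne]
  · simp
  · have : x.val i j = 0 := hx h
    simp [h.ne', h.not_gt, this]

theorem exists_eq_borel_add_nMinus (x : Sl n) :
    ∃ b ∈ borel n, ∃ y ∈ nMinus n, x = b + y := by
  have h1 : ∀ i j : Fin n, j < i → (diagPart x + upperPart x).val i j = 0 := fun i j hij => by
    change Matrix.diagonal (fun i => x.val i i) i j + (if i < j then x.val i j else 0) = 0
    simp [hij.ne', hij.not_gt]
  refine ⟨diagPart x + upperPart x, fun i j hij => h1 i j hij, x - (diagPart x + upperPart x), ?_,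
    by abel⟩
  intro i j hij
  change x.val i j
    - (Matrix.diagonal (fun i => x.val i i) i j + if i < j then x.val i j else 0) = 0
  rcases hij.lt_or_eq with h | rfl
  · simp [h, h.ne]
  · simp

/-- The weight `ε_i - ε_j`. -/
def rootForm (i j : Fin n) : Sl n →ₗ[ℂ] ℂ where
  toFun x := x.val i i - x.val j j
  map_add' x y := by
    change x.val i i + y.val i i - (x.val j j + y.val j j) = _
    ring
  map_smul' c x := by
    change c * x.val i i - c * x.val j j = c * (x.val i i - x.val j j)
    ring

theorem lie_single_of_mem_cartan {h : Sl n} (hh : h ∈ cartan n) {i j : Fin n} (hij : i ≠ j)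
    (c : ℂ) : ⁅h, LieAlgebra.SpecialLinear.single i j hij c⁆
      = rootForm i j h • LieAlgebra.SpecialLinear.single i j hij c := by
  have hd : h.val = Matrix.diagonal fun a => h.val a a := by
    ext a b
    rcases eq_or_ne a b with rfl | hab
    · simp
    · rw [hh a b hab, Matrix.diagonal_apply_ne _ hab]
  apply Subtype.ext
  rw [LieAlgebra.SpecialLinear.sl_bracket]
  change h.val * Matrix.single i j c - Matrix.single i j c * h.val
    = (h.val i i - h.val j j) • Matrix.single i j c
  ext a b
  rw [Matrix.sub_apply, hd, Matrix.diagonal_mul, Matrix.mul_diagonal, Matrix.smul_apply,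
    Matrix.single_apply]
  split_ifs with hab
  · obtain ⟨rfl, rfl⟩ := hab
    simp
    ring
  · simp

theorem lie_of_mem_cartan {h x : Sl n} (hh : h ∈ cartan n) (hx : x ∈ cartan n) : ⁅h, x⁆ = 0 := by
  have hd : ∀ {y : Sl n}, y ∈ cartan n → y.val = Matrix.diagonal fun a => y.val a a := by
    intro y hy
    ext a b
    rcases eq_or_ne a b with rfl | hab
    · simp
    · rw [hy a b hab, Matrix.diagonal_apply_ne _ hab]
  apply Subtype.ext
  rw [LieAlgebra.SpecialLinear.sl_bracket, hd hh, hd hx, Matrix.diagonal_mul_diagonal,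
    Matrix.diagonal_mul_diagonal]
  change _ = (0 : Matrix (Fin n) (Fin n) ℂ)
  simp [mul_comm]

/-- The weight vectors of `sl_n` span it. -/
theorem weight_induction {P : Sl n → Prop} (hadd : ∀ x y, P x → P y → P (x + y)) (h0 : P 0)
    (hw : ∀ (x : Sl n) (α : Sl n →ₗ[ℂ] ℂ), (∀ h ∈ cartan n, ⁅h, x⁆ = α h • x) → P x) (x : Sl n) :
    P x := by
  have hsum : x = diagPart x + ∑ i, ∑ j, if hij : i ≠ j then
      LieAlgebra.SpecialLinear.single i j hij (x.val i j) else 0 := by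
    apply Subtype.ext
    change x.val = (diagPart x).val + (∑ i, ∑ j, _ : Sl n).val
    have hc : ∀ i j : Fin n, ((if hij : i ≠ j then
        LieAlgebra.SpecialLinear.single i j hij (x.val i j) else 0 : Sl n)).val
        = if i ≠ j then Matrix.single i j (x.val i j) else 0 := by
      intro i j
      split_ifs <;> rfl
    have hv : ∀ (s : Fin n → Sl n), (∑ i, s i).val = ∑ i, (s i).val := fun s =>
      map_sum (LieAlgebra.SpecialLinear.sl (Fin n) ℂ).subtype s _
    rw [hv]
    simp only [hv, hc]
    ext a b
    rw [Matrix.add_apply]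
    change _ = Matrix.diagonal (fun i => x.val i i) a b + _
    rw [Matrix.sum_apply, Finset.sum_eq_single a, Matrix.sum_apply, Finset.sum_eq_single b]
    · rcases eq_or_ne a b with rfl | hab
      · simp
      · simp [hab]
    · intro j _ hj
      split_ifs <;> simp [hj]
    · simp
    · intro i _ hi
      rw [Matrix.sum_apply]
      refine Finset.sum_eq_zero fun j _ => ?_
      split_ifs <;> simp [hi]
    · simp
  rw [hsum]
  refine hadd _ _ (hw _ 0 fun h hh => ?_) ?_
  · rw [lie_of_mem_cartan hh (diagPart_mem_cartan x), LinearMap.zero_apply, zero_smul]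
  · refine Finset.sum_induction _ P hadd h0 fun i _ => ?_
    refine Finset.sum_induction _ P hadd h0 fun j _ => ?_
    split_ifs with hij
    · exact hw _ (rootForm i j) fun h hh => lie_single_of_mem_cartan hh hij _
    · exact h0

theorem ad_pow_three {x : Sl n} (hx : x.val * x.val = 0) :
    LieAlgebra.ad ℂ (Cur n) ((1 : ℂ[X]) ⊗ₜ[ℂ] x) ^ 3 = 0 := by
  refine TensorProduct.ext' fun p y => ?_
  have h : ⁅x, ⁅x, ⁅x, y⁆⁆⁆ = 0 := by
    apply Subtype.ext
    simp only [LieAlgebra.SpecialLinear.sl_bracket]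
    change _ = (0 : Matrix (Fin n) (Fin n) ℂ)
    have h1 : ∀ z : Matrix (Fin n) (Fin n) ℂ, x.val * (x.val * z) = 0 := fun z => by
      rw [← mul_assoc, hx, zero_mul]
    simp [mul_sub, sub_mul, mul_assoc, hx, h1]
  simp only [pow_succ, pow_zero, one_mul, Module.End.mul_apply, LieAlgebra.ad_apply,
    LieAlgebra.ExtendScalars.bracket_tmul, h, TensorProduct.tmul_zero, LinearMap.zero_apply]

theorem rootE_mul_self {i j : Fin n} (hij : i < j) : (rootE hij).val * (rootE hij).val = 0 := by
  simp [rootE, Matrix.single_mul_single_of_ne, hij.ne']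

theorem rootF_mul_self {i j : Fin n} (hij : i < j) : (rootF hij).val * (rootF hij).val = 0 := by
  simp [rootF, Matrix.single_mul_single_of_ne, hij.ne]

end Roots

/-! ### Integrability of cyclic modules -/

section Integrable

variable {n : ℕ}

theorem isIntegrable_of_generator {V : Type*} [AddCommGroup V] [Module (U (Cur n)) V] {g : V}
    (hg : Submodule.span (U (Cur n)) {g} = ⊤) (μ : Sl n →ₗ[ℂ] ℂ)
    (hμ : ∀ h ∈ cartan n, toU ((1 : ℂ[X]) ⊗ₜ[ℂ] h : Cur n) • g
      = algebraMap ℂ (U (Cur n)) (μ h) • g)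
    (hE : ∀ (i j : Fin n) (hij : i < j), toU ((1 : ℂ[X]) ⊗ₜ[ℂ] rootE hij : Cur n) • g = 0)
    (hF : ∀ (i j : Fin n) (hij : i < j), ∃ N : ℕ,
      toU ((1 : ℂ[X]) ⊗ₜ[ℂ] rootF hij : Cur n) ^ N • g = 0) :
    IsIntegrable n V where
  nilpE i j hij v := exists_pow_smul_eq_zero hg _ (ad_pow_three (rootE_mul_self hij))
    ⟨1, by rw [pow_one]; exact hE i j hij⟩ v
  nilpF i j hij v := exists_pow_smul_eq_zero hg _ (ad_pow_three (rootF_mul_self hij))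
    (hF i j hij) v
  weights := by
    refine eq_top_of_generator hg _ (AddSubgroup.subset_closure ⟨μ, hμ⟩) ?_ ?_
    · intro c v hv
      induction hv using AddSubgroup.closure_induction with
      | mem v hv =>
        obtain ⟨ν, hν⟩ := hv
        refine AddSubgroup.subset_closure ⟨ν, fun h hh => ?_⟩
        rw [algebraMap_smul_comm, hν h hh, algebraMap_smul_comm]
      | zero => rw [smul_zero]; exact AddSubgroup.zero_mem _
      | add a b _ _ ha hb => rw [smul_add]; exact AddSubgroup.add_mem _ ha hb
      | neg a _ ha => rw [smul_neg]; exact AddSubgroup.neg_mem _ ha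
    · intro y v hv
      induction y using TensorProduct.induction_on with
      | zero => rw [toU_zero, zero_smul]; exact AddSubgroup.zero_mem _
      | add a b ha hb => rw [toU_add, add_smul]; exact AddSubgroup.add_mem _ ha hb
      | tmul p y =>
        induction y using weight_induction with
        | hadd a b ha hb =>
          rw [TensorProduct.tmul_add, toU_add, add_smul]; exact AddSubgroup.add_mem _ ha hb
        | h0 =>
          rw [TensorProduct.tmul_zero, toU_zero, zero_smul]; exact AddSubgroup.zero_mem _
        | hw y α hα =>
          induction hv using AddSubgroup.closure_induction with
          | mem v hv =>
            obtain ⟨ν, hν⟩ := hv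
            refine AddSubgroup.subset_closure ⟨ν + α, fun h hh => ?_⟩
            rw [← mul_smul, toU_mul_toU, add_smul, mul_smul, hν h hh,
              LieAlgebra.ExtendScalars.bracket_tmul, one_mul, hα h hh, TensorProduct.tmul_smul,
              toU_smul, Algebra.smul_def, mul_smul, LinearMap.add_apply, map_add,
              add_smul, algebraMap_smul_comm]
          | zero => rw [smul_zero]; exact AddSubgroup.zero_mem _
          | add a b _ _ ha hb => rw [smul_add]; exact AddSubgroup.add_mem _ ha hb
          | neg a _ ha => rw [smul_neg]; exact AddSubgroup.neg_mem _ ha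

end Integrable

/-! ### The presentation of the module induced from `M` -/

section Presentation

variable {n : ℕ} (l₁ l₂ : DomWeight n)

theorem span_oneDimGen (lam : DomWeight n) :
    Submodule.span (U (CurBorel n)) {oneDimGen lam} = ⊤ := by
  rw [eq_top_iff]
  intro c _
  refine Submodule.mem_span_singleton.2 ⟨algebraMap ℂ _ (c : ℂ), ?_⟩
  change UniversalEnvelopingAlgebra.lift ℂ (borelChar lam) (algebraMap ℂ _ (c : ℂ)) * (1 : ℂ) = c
  rw [mul_one]
  exact AlgHom.commutes _ _

/-- The canonical generator of the module induced from `M`. -/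
def genIndM : IndM l₁ l₂ :=
  indOne (uMap (mid n).incl).toRingHom ((relM l₁ l₂).mkQ (indOneDimGen (l₁ + l₂)))

theorem span_genIndM : Submodule.span (U (Cur n)) {genIndM l₁ l₂} = ⊤ := by
  exact span_indOne _ (span_mkQ_eq_top (span_indOne _ (span_oneDimGen _)) _)

theorem uMap_incl_smul_genIndM (u : U (mid n)) : uMap (mid n).incl u • genIndM l₁ l₂
    = indOne (uMap (mid n).incl).toRingHom
      ((relM l₁ l₂).mkQ (u • indOneDimGen (l₁ + l₂))) := by
  rw [map_smul]
  exact (indOne_smul _ _ _).symm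

theorem uMap_borelToMid_smul_eq (lam : DomWeight n) {u u' : U (CurBorel n)}
    (h : u • oneDimGen lam = u' • oneDimGen lam) :
    uMap (borelToMid n) u • indOneDimGen lam = uMap (borelToMid n) u' • indOneDimGen lam :=
  (indOne_smul (uMap (borelToMid n)).toRingHom u _).symm.trans
    ((congrArg _ h).trans (indOne_smul (uMap (borelToMid n)).toRingHom u' _))

theorem borelChar_tmul (lam : DomWeight n) (p : ℂ[X]) (b : borel n) :
    borelChar lam (p ⊗ₜ[ℂ] b) = p.eval 0 * wt lam b.val := by
  change wt lam ((evalZero (borel n) (p ⊗ₜ[ℂ] b)).val) = _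
  rw [evalZero_tmul]
  change wt lam (p.eval 0 • b.val) = _
  rw [map_smul, smul_eq_mul]

theorem toU_smul_oneDimGen (lam : DomWeight n) (p : ℂ[X]) (b : borel n) :
    toU (p ⊗ₜ[ℂ] b : CurBorel n) • oneDimGen lam
      = algebraMap ℂ (U (CurBorel n)) (p.eval 0 * wt lam b.val) • oneDimGen lam := by
  change UniversalEnvelopingAlgebra.lift ℂ (borelChar lam)
    (UniversalEnvelopingAlgebra.ι ℂ _) * (1 : ℂ)
      = UniversalEnvelopingAlgebra.lift ℂ (borelChar lam) (algebraMap ℂ _ _) * (1 : ℂ)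
  rw [UniversalEnvelopingAlgebra.lift_ι_apply, AlgHom.commutes, borelChar_tmul]
  rfl

theorem borel_smul_genIndM (p : ℂ[X]) {b : Sl n} (hb : b ∈ borel n) :
    toU (p ⊗ₜ[ℂ] b : Cur n) • genIndM l₁ l₂
      = algebraMap ℂ (U (Cur n)) (p.eval 0 * wt (l₁ + l₂) b) • genIndM l₁ l₂ := by
  have h := congrArg (fun v => indOne (uMap (mid n).incl).toRingHom ((relM l₁ l₂).mkQ v))
    (uMap_borelToMid_smul_eq _ (toU_smul_oneDimGen (l₁ + l₂) p ⟨b, hb⟩))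
  simp only [← uMap_incl_smul_genIndM] at h
  have h1 : uMap (mid n).incl (uMap (borelToMid n) (toU (p ⊗ₜ[ℂ] ⟨b, hb⟩)))
      = toU (p ⊗ₜ[ℂ] b : Cur n) := by
    rw [uMap_toU, uMap_toU]; rfl
  have h2 : uMap (mid n).incl (uMap (borelToMid n) (algebraMap ℂ _ (p.eval 0 * wt (l₁ + l₂) b)))
      = algebraMap ℂ (U (Cur n)) (p.eval 0 * wt (l₁ + l₂) b) := by
    rw [AlgHom.commutes, AlgHom.commutes]
  rwa [h1, h2] at h

theorem nMinus_smul_genIndM (p : ℂ[X]) {x : Sl n} (hx : x ∈ nMinus n) :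
    toU ((Polynomial.X ^ 2 * p) ⊗ₜ[ℂ] x : Cur n) • genIndM l₁ l₂ = 0 := by
  have hmem : ((Polynomial.X ^ 2 * p) ⊗ₜ[ℂ] x : Cur n) ∈ mid n := by
    change evalZero (Sl n) _ ∈ borel n
    simp
  have h1 : toU ((Polynomial.X ^ 2 * p) ⊗ₜ[ℂ] x : Cur n)
      = uMap (mid n).incl (toU ⟨_, hmem⟩) := by
    rw [uMap_toU]; rfl
  rw [h1, uMap_incl_smul_genIndM, Submodule.mkQ_apply, (Submodule.Quotient.mk_eq_zero _).2,
    indOne_zero]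
  exact Submodule.subset_span (Or.inl ⟨_, p, x, hx, rfl, rfl⟩)

/-- The universal property of the module induced from `ℂ_lam` to the intermediate algebra, with
values in modules over an extension. -/
theorem exists_lift_indOneDim {T W : Type*} [Ring T] [AddCommGroup W] [Module T W]
    (lam : DomWeight n) (σ : U (Cur n) →+* T) (w : W)
    (hb : ∀ (p : ℂ[X]), ∀ b ∈ borel n, σ (toU (p ⊗ₜ[ℂ] b : Cur n)) • w
      = σ (algebraMap ℂ (U (Cur n)) (p.eval 0 * wt lam b)) • w) :
    ∃ Φ : IndOneDim lam →ₛₗ[σ.comp (uMap (mid n).incl).toRingHom] W,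
      Φ (indOneDimGen lam) = w := by
  set χ : U (CurBorel n) →ₐ[ℂ] ℂ := UniversalEnvelopingAlgebra.lift ℂ (borelChar lam) with hχ
  set ρ : U (CurBorel n) →ₐ[ℂ] U (Cur n) := (uMap (mid n).incl).comp (uMap (borelToMid n)) with hρ
  have comm : ∀ (c : ℂ) (u : U (Cur n)), σ u • σ (algebraMap ℂ _ c) • w
      = σ (algebraMap ℂ _ c) • σ u • w := fun c u => by
    rw [← mul_smul, ← mul_smul, ← map_mul, ← map_mul, Algebra.commutes]
  have key : ∀ r : U (CurBorel n), σ (ρ r) • w = σ (algebraMap ℂ _ (χ r)) • w := by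
    intro r
    have hr : r ∈ Algebra.adjoin ℂ (Set.range (toU : CurBorel n → U (CurBorel n))) := by
      rw [adjoin_range_toU]; trivial
    induction hr using Algebra.adjoin_induction with
    | mem r hr =>
      obtain ⟨x, rfl⟩ := hr
      induction x using TensorProduct.induction_on with
      | zero => simp only [map_zero]
      | add x y hx hy => simp only [map_add, add_smul, hx, hy]
      | tmul p b =>
        have h1 : ρ (toU (p ⊗ₜ[ℂ] b)) = toU (p ⊗ₜ[ℂ] b.val : Cur n) := by
          rw [hρ, AlgHom.comp_apply, uMap_toU, uMap_toU]; rfl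
        rw [h1, hb p b.val b.2, hχ, toU, UniversalEnvelopingAlgebra.lift_ι_apply, borelChar_tmul]
    | algebraMap c => rw [AlgHom.commutes, AlgHom.commutes]; rfl
    | add a b _ _ ha hb' => simp only [map_add, add_smul, ha, hb']
    | mul a b _ _ ha hb' => 
      rw [map_mul, map_mul, map_mul, map_mul, map_mul, mul_smul, mul_smul, hb', comm, ha, comm]
  let φ₀ : OneDim lam →ₛₗ[(σ.comp (uMap (mid n).incl).toRingHom).comp
      (uMap (borelToMid n)).toRingHom] W :=
    { toFun := fun c => σ (algebraMap ℂ (U (Cur n)) (show ℂ from c)) • w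
      map_add' := fun c d => by
        change σ (algebraMap ℂ (U (Cur n)) ((show ℂ from c) + (show ℂ from d))) • w = _
        rw [map_add, map_add, add_smul]
      map_smul' := fun r c => by
        change σ (algebraMap ℂ (U (Cur n)) (χ r * (show ℂ from c))) • w
          = σ (ρ r) • σ (algebraMap ℂ (U (Cur n)) (show ℂ from c)) • w
        rw [comm, key, mul_comm, map_mul, map_mul, mul_smul] }
  refine (exists_indLift (uMap (borelToMid n)).toRingHom
    (σ.comp (uMap (mid n).incl).toRingHom) φ₀).imp fun Φ hΦ => (hΦ _).trans ?_
  change σ (algebraMap ℂ (U (Cur n)) (1 : ℂ)) • w = w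
  rw [map_one, map_one, one_smul]

/-- The universal property of the module induced from `M`, with values in modules over an
extension. -/
theorem exists_lift_indM {T W : Type*} [Ring T] [AddCommGroup W] [Module T W]
    (σ : U (Cur n) →+* T) (w : W)
    (hb : ∀ (p : ℂ[X]), ∀ b ∈ borel n, σ (toU (p ⊗ₜ[ℂ] b : Cur n)) • w
      = σ (algebraMap ℂ (U (Cur n)) (p.eval 0 * wt (l₁ + l₂) b)) • w)
    (hn : ∀ (p : ℂ[X]), ∀ x ∈ nMinus n,
      σ (toU ((Polynomial.X ^ 2 * p) ⊗ₜ[ℂ] x : Cur n)) • w = 0)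
    (hf : ∀ (i j : Fin n) (hij : i < j), σ (toU ((Polynomial.X : ℂ[X]) ⊗ₜ[ℂ] rootF hij : Cur n))
      ^ (min (pairing l₁ i j) (pairing l₂ i j) + 1) • w = 0) :
    ∃ ψ : IndM l₁ l₂ →ₛₗ[σ] W, ψ (genIndM l₁ l₂) = w := by
  refine (exists_lift_indOneDim (l₁ + l₂) σ w hb).elim fun Φ₁ hgen => ?_
  have hsmul : ∀ u : U (mid n), Φ₁ (u • indOneDimGen (l₁ + l₂))
      = σ (uMap (mid n).incl u) • w := fun u =>
    (Φ₁.map_smulₛₗ u _).trans (congrArg (fun v => σ (uMap (mid n).incl u) • v) hgen)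
  have hle : relM l₁ l₂ ≤ LinearMap.ker Φ₁ := by
    refine Submodule.span_le.2 ?_
    rintro _ (⟨y, p, x, hx, hy, rfl⟩ | ⟨y, i, j, hij, hy, rfl⟩)
    · refine (hsmul _).trans ?_
      rw [uMap_toU]
      change σ (toU y.val) • w = 0
      rw [hy, hn p x hx]
    · refine (hsmul _).trans ?_
      rw [map_pow, map_pow, uMap_toU]
      change σ (toU y.val) ^ _ • w = 0
      rw [hy, hf i j hij]
  exact (exists_indLift_quotient (uMap (mid n).incl).toRingHom σ (relM l₁ l₂) Φ₁ hle).imp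
    fun ψ hψ => (hψ _).trans hgen

end Presentation

/-! ### The truncation map -/

section Truncation

variable {n : ℕ}

theorem truncate_tmul (p : ℂ[X]) (x : Sl n) :
    truncate n (p ⊗ₜ[ℂ] x) = (Ideal.Quotient.mk _ p : A) ⊗ₜ[ℂ] x := rfl

theorem truncate_surjective : Function.Surjective (truncate n) := by
  intro z
  induction z using TensorProduct.induction_on with
  | zero => exact ⟨0, map_zero _⟩
  | add x y hx hy =>
    obtain ⟨a, rfl⟩ := hx
    obtain ⟨b, rfl⟩ := hy
    exact ⟨a + b, map_add _ _ _⟩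
  | tmul a x =>
    obtain ⟨p, rfl⟩ := Ideal.Quotient.mk_surjective a
    exact ⟨p ⊗ₜ x, rfl⟩

theorem uMap_surjective {L L' : Type*} [LieRing L] [LieAlgebra ℂ L] [LieRing L'] [LieAlgebra ℂ L']
    {f : L →ₗ⁅ℂ⁆ L'} (hf : Function.Surjective f) : Function.Surjective (uMap f) := by
  rw [← AlgHom.range_eq_top, eq_top_iff, ← adjoin_range_toU, Algebra.adjoin_le_iff]
  rintro _ ⟨y, rfl⟩
  obtain ⟨x, rfl⟩ := hf y
  exact ⟨toU x, uMap_toU f x⟩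

/-- The kernel of truncation is `sl_n ⊗ t²ℂ[t]`. -/
theorem mem_span_of_truncate_eq_zero {z : Cur n} (hz : truncate n z = 0) :
    z ∈ AddSubgroup.closure
      {z : Cur n | ∃ (p : ℂ[X]) (x : Sl n), z = (Polynomial.X ^ 2 * p) ⊗ₜ[ℂ] x} := by
  set I : Ideal ℂ[X] := Ideal.span {(Polynomial.X : ℂ[X]) ^ 2} with hI
  have hex : Function.Exact (I.restrictScalars ℂ).subtype
      (Ideal.Quotient.mkₐ ℂ I).toLinearMap := by
    intro p
    change Ideal.Quotient.mk I p = 0 ↔ p ∈ Set.range (I.restrictScalars ℂ).subtype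
    rw [Ideal.Quotient.eq_zero_iff_mem]
    simp
  have h := rTensor_exact (Sl n) hex Ideal.Quotient.mk_surjective
  obtain ⟨y, rfl⟩ := (h z).1 hz
  induction y using TensorProduct.induction_on with
  | zero => rw [map_zero]; exact AddSubgroup.zero_mem _
  | add a b ha hb =>
    rw [map_add]
    exact AddSubgroup.add_mem _ (ha ((h _).2 ⟨a, rfl⟩)) (hb ((h _).2 ⟨b, rfl⟩))
  | tmul p x =>
    obtain ⟨q, hq⟩ := Ideal.mem_span_singleton'.1 p.2
    refine AddSubgroup.subset_closure ⟨q, x, ?_⟩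
    rw [LinearMap.rTensor_tmul]
    change p.val ⊗ₜ[ℂ] x = _
    rw [← hq, mul_comm]

theorem tA_mul_tA : tA * tA = 0 := by
  rw [tA, ← map_mul, ← pow_two, Ideal.Quotient.eq_zero_iff_mem]
  exact Ideal.mem_span_singleton_self _

theorem mk_X_sq_mul (p : ℂ[X]) : (Ideal.Quotient.mk _ (Polynomial.X ^ 2 * p) : A) = 0 := by
  rw [Ideal.Quotient.eq_zero_iff_mem]
  exact Ideal.mul_mem_right _ _ (Ideal.mem_span_singleton_self _)

theorem mk_eq_eval_add (p : ℂ[X]) : ∃ c : ℂ,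
    (Ideal.Quotient.mk _ p : A) = p.eval 0 • (1 : A) + c • tA := by
  obtain ⟨q, hq⟩ : Polynomial.X ∣ p - Polynomial.C (p.eval 0) := by
    rw [Polynomial.X_dvd_iff, Polynomial.coeff_zero_eq_eval_zero]; simp
  obtain ⟨q', hq'⟩ : Polynomial.X ∣ q - Polynomial.C (q.eval 0) := by
    rw [Polynomial.X_dvd_iff, Polynomial.coeff_zero_eq_eval_zero]; simp
  refine ⟨q.eval 0, ?_⟩
  have h : p = p.eval 0 • (1 : ℂ[X]) + q.eval 0 • Polynomial.X + Polynomial.X ^ 2 * q' := by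
    rw [Polynomial.smul_eq_C_mul, Polynomial.smul_eq_C_mul]
    linear_combination hq + Polynomial.X * hq'
  conv_lhs => rw [h, map_add, mk_X_sq_mul, add_zero, map_add]
  rfl

end Truncation

/-! ### The graded local Weyl module -/

section WeylModule

variable {n : ℕ} (lam : DomWeight n)

/-- The generator of the graded local Weyl module. -/
def weylGen : Weyl lam := (weylRel lam).mkQ 1

theorem smul_weylGen (u : U (CurA n)) : u • weylGen lam = (weylRel lam).mkQ u := by
  rw [weylGen, ← map_smul, smul_eq_mul, mul_one]

theorem smul_weylGen_eq_zero {u : U (CurA n)} (hu : u ∈ weylRel lam) : u • weylGen lam = 0 := by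
  rw [smul_weylGen, Submodule.mkQ_apply, (Submodule.Quotient.mk_eq_zero _).2 hu]

theorem tA_smul_weylGen {x : Sl n} (hx : x ∈ borel n) :
    toU (tA ⊗ₜ[ℂ] x : CurA n) • weylGen lam = 0 :=
  smul_weylGen_eq_zero lam (Submodule.subset_span (Or.inl (Or.inl (Or.inl ⟨x, hx, rfl⟩))))

theorem cartan_smul_weylGen {h : Sl n} (hh : h ∈ cartan n) :
    toU ((1 : A) ⊗ₜ[ℂ] h : CurA n) • weylGen lam
      = algebraMap ℂ (U (CurA n)) (wt lam h) • weylGen lam := by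
  rw [← sub_eq_zero, ← sub_smul]
  exact smul_weylGen_eq_zero lam (Submodule.subset_span (Or.inl (Or.inl (Or.inr ⟨h, hh, rfl⟩))))

theorem nPlus_smul_weylGen {x : Sl n} (hx : x ∈ nPlus n) :
    toU ((1 : A) ⊗ₜ[ℂ] x : CurA n) • weylGen lam = 0 :=
  smul_weylGen_eq_zero lam (Submodule.subset_span (Or.inl (Or.inr ⟨x, hx, rfl⟩)))

theorem rootF_pow_smul_weylGen {i j : Fin n} (hij : i < j) :
    toU ((1 : A) ⊗ₜ[ℂ] rootF hij : CurA n) ^ (pairing lam i j + 1) • weylGen lam = 0 :=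
  smul_weylGen_eq_zero lam (Submodule.subset_span (Or.inr ⟨i, j, hij, rfl⟩))

theorem borel_smul_weylGen (p : ℂ[X]) {b : Sl n} (hb : b ∈ borel n) :
    toU (truncate n (p ⊗ₜ[ℂ] b)) • weylGen lam
      = algebraMap ℂ (U (CurA n)) (p.eval 0 * wt lam b) • weylGen lam := by
  obtain ⟨c, hc⟩ := mk_eq_eval_add p
  have h1 : toU ((1 : A) ⊗ₜ[ℂ] b : CurA n) • weylGen lam
      = algebraMap ℂ (U (CurA n)) (wt lam b) • weylGen lam := by
    have hw : wt lam b = wt lam (diagPart b) := by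
      conv_lhs => rw [eq_diagPart_add_upperPart hb]
      rw [map_add, wt_of_mem_nPlus lam (upperPart_mem_nPlus b), add_zero]
    conv_lhs => rw [eq_diagPart_add_upperPart hb]
    rw [TensorProduct.tmul_add, toU_add, add_smul,
      nPlus_smul_weylGen lam (upperPart_mem_nPlus b),
      cartan_smul_weylGen lam (diagPart_mem_cartan b), add_zero, hw]
  rw [truncate_tmul, hc, TensorProduct.add_tmul, ← TensorProduct.smul_tmul',
    ← TensorProduct.smul_tmul', toU_add, toU_smul, toU_smul, add_smul,
    Algebra.smul_def, Algebra.smul_def, mul_smul, mul_smul, h1, tA_smul_weylGen lam hb, smul_zero,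
    add_zero, map_mul, mul_smul]

theorem tA_rootF_pow_smul_weylGen {i j : Fin n} (hij : i < j) :
    toU (tA ⊗ₜ[ℂ] rootF hij : CurA n) ^ (pairing lam i j / 2 + 1) • weylGen lam = 0 := by
  refine truncated_pow_smul_eq_zero (e := toU (tA ⊗ₜ[ℂ] rootE hij : CurA n))
    (f := toU ((1 : A) ⊗ₜ[ℂ] rootF hij : CurA n)) (h := toU (tA ⊗ₜ[ℂ] coroot i j : CurA n))
    ?_ ?_ ?_ ?_ ?_ ?_ ?_
  · rw [toU_mul_toU, LieAlgebra.ExtendScalars.bracket_tmul, mul_one, lie_rootE_rootF]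
  · rw [toU_mul_toU, LieAlgebra.ExtendScalars.bracket_tmul, mul_one, lie_coroot_rootF,
      TensorProduct.tmul_neg, TensorProduct.tmul_smul, toU_neg, toU_smul,
      ← sub_eq_add_neg]
  · rw [toU_mul_toU, LieAlgebra.ExtendScalars.bracket_tmul, lie_self, TensorProduct.tmul_zero,
      toU_zero, add_zero]
  · rw [toU_mul_toU, LieAlgebra.ExtendScalars.bracket_tmul, tA_mul_tA, TensorProduct.zero_tmul,
      toU_zero, add_zero]
  · exact tA_smul_weylGen lam (nPlus_subset_borel (rootE_mem_nPlus hij))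
  · exact tA_smul_weylGen lam (cartan_subset_borel (coroot_mem_cartan i j))
  · obtain ⟨k, hk⟩ : ∃ k, 2 * (pairing lam i j / 2 + 1) = k + (pairing lam i j + 1) :=
      ⟨2 * (pairing lam i j / 2 + 1) - (pairing lam i j + 1), by omega⟩
    rw [hk, pow_add, mul_smul, rootF_pow_smul_weylGen lam hij, smul_zero]

end WeylModule

/-! ### Highest weight modules killed by `sl_n ⊗ t²ℂ[t]` -/

section HighestWeight

variable {n : ℕ} {lam : DomWeight n} {V : Type*} [AddCommGroup V] [Module (U (Cur n)) V] {g : V}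

/-- The ideal `sl_n ⊗ t²ℂ[t]` kills the generator. -/
theorem toU_smul_eq_zero_of_truncate
    (hb : ∀ (p : ℂ[X]), ∀ b ∈ borel n, toU (p ⊗ₜ[ℂ] b : Cur n) • g
      = algebraMap ℂ (U (Cur n)) (p.eval 0 * wt lam b) • g)
    (hn : ∀ (p : ℂ[X]), ∀ x ∈ nMinus n, toU ((Polynomial.X ^ 2 * p) ⊗ₜ[ℂ] x : Cur n) • g = 0)
    (z : Cur n) (hz : truncate n z = 0) : toU z • g = 0 := by
  replace hz := mem_span_of_truncate_eq_zero hz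
  induction hz using AddSubgroup.closure_induction with
  | mem z hz =>
    obtain ⟨p, x, rfl⟩ := hz
    obtain ⟨b, hbm, y, hy, rfl⟩ := exists_eq_borel_add_nMinus x
    rw [TensorProduct.tmul_add, toU_add, add_smul, hn p y hy, hb _ b hbm]
    simp
  | zero => rw [toU_zero, zero_smul]
  | add a b _ _ ha hb => rw [toU_add, add_smul, ha, hb, add_zero]
  | neg a _ ha => rw [toU_neg, neg_smul, ha, neg_zero]

theorem rootF_pow_smul_eq_zero
    (hb : ∀ (p : ℂ[X]), ∀ b ∈ borel n, toU (p ⊗ₜ[ℂ] b : Cur n) • g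
      = algebraMap ℂ (U (Cur n)) (p.eval 0 * wt lam b) • g)
    {i j : Fin n} (hij : i < j)
    (hf : ∃ N : ℕ, toU ((1 : ℂ[X]) ⊗ₜ[ℂ] rootF hij : Cur n) ^ N • g = 0) :
    toU ((1 : ℂ[X]) ⊗ₜ[ℂ] rootF hij : Cur n) ^ (pairing lam i j + 1) • g = 0 := by
  let _ : Module ℂ V := Module.compHom V (algebraMap ℂ (U (Cur n)))
  have hsmul : ∀ (c : ℂ) (v : V), c • v = algebraMap ℂ (U (Cur n)) c • v := fun _ _ => rfl
  have : IsScalarTower ℂ (U (Cur n)) V := ⟨fun c u v => by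
    rw [Algebra.smul_def, mul_smul]; rfl⟩
  refine sl2_pow_smul_eq_zero (e := toU ((1 : ℂ[X]) ⊗ₜ[ℂ] rootE hij : Cur n))
    (h := toU ((1 : ℂ[X]) ⊗ₜ[ℂ] coroot i j : Cur n)) ?_ ?_ ?_ ?_ hf
  · rw [toU_mul_toU, LieAlgebra.ExtendScalars.bracket_tmul, mul_one, lie_rootE_rootF]
  · rw [toU_mul_toU, LieAlgebra.ExtendScalars.bracket_tmul, mul_one, lie_coroot_rootF,
      TensorProduct.tmul_neg, TensorProduct.tmul_smul, toU_neg, toU_smul, ← sub_eq_add_neg]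
  · rw [hb _ _ (nPlus_subset_borel (rootE_mem_nPlus hij)),
      wt_of_mem_nPlus lam (rootE_mem_nPlus hij), mul_zero, map_zero, zero_smul]
  · rw [hb _ _ (cartan_subset_borel (coroot_mem_cartan i j)), wt_coroot lam hij, hsmul]
    simp

theorem rootF_pow_smul_mem_intKer
    (hb : ∀ (p : ℂ[X]), ∀ b ∈ borel n, toU (p ⊗ₜ[ℂ] b : Cur n) • g
      = algebraMap ℂ (U (Cur n)) (p.eval 0 * wt lam b) • g)
    {i j : Fin n} (hij : i < j) :
    toU ((1 : ℂ[X]) ⊗ₜ[ℂ] rootF hij : Cur n) ^ (pairing lam i j + 1) • g ∈ intKer n V := by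
  refine Submodule.mem_sInf.2 fun N hN => ?_
  have hN : IsIntegrable n (V ⧸ N) := hN
  rw [← Submodule.Quotient.mk_eq_zero, Submodule.Quotient.mk_smul]
  refine rootF_pow_smul_eq_zero (fun p b hbm => ?_) hij (hN.nilpF i j hij _)
  rw [← Submodule.Quotient.mk_smul, hb p b hbm, Submodule.Quotient.mk_smul]

/-- The kernel of a map of a cyclic module to the Weyl module contains `intKer`. -/
theorem intKer_le_ker (hg : Submodule.span (U (Cur n)) {g} = ⊤)
    (ψ : V →ₛₗ[(uMap (truncate n)).toRingHom] Weyl lam) (hψ : ψ g = weylGen lam) :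
    intKer n V ≤ LinearMap.ker ψ := by
  have hsmul : ∀ u : U (Cur n), ψ (u • g) = uMap (truncate n) u • weylGen lam := fun u => by
    rw [LinearMap.map_smulₛₗ, hψ]; rfl
  have hzero : ∀ u : U (Cur n), uMap (truncate n) u • weylGen lam = 0 →
      u • (LinearMap.ker ψ).mkQ g = 0 := fun u hu => by
    rw [← map_smul, Submodule.mkQ_apply, Submodule.Quotient.mk_eq_zero, LinearMap.mem_ker, hsmul,
      hu]
  refine sInf_le ?_
  refine isIntegrable_of_generator (g := (LinearMap.ker ψ).mkQ g) ?_ (wt lam) ?_ ?_ ?_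
  · exact span_mkQ_eq_top hg _
  · intro h hh
    rw [← sub_eq_zero, ← sub_smul]
    refine hzero _ ?_
    rw [map_sub, sub_smul, AlgHom.commutes, uMap_toU,
      borel_smul_weylGen lam 1 (cartan_subset_borel hh)]
    simp
  · intro i j hij
    refine hzero _ ?_
    rw [uMap_toU, borel_smul_weylGen lam 1 (nPlus_subset_borel (rootE_mem_nPlus hij)),
      wt_of_mem_nPlus lam (rootE_mem_nPlus hij), mul_zero, map_zero, zero_smul]
  · intro i j hij
    refine ⟨pairing lam i j + 1, hzero _ ?_⟩
    rw [map_pow, uMap_toU]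
    exact rootF_pow_smul_weylGen lam hij

/-- A cyclic highest weight module that is killed by `n⁻ ⊗ t²ℂ[t]` at its generator and maps onto
the graded local Weyl module has it as its maximal integrable quotient. -/
theorem exists_weyl_equiv (hg : Submodule.span (U (Cur n)) {g} = ⊤)
    (hb : ∀ (p : ℂ[X]), ∀ b ∈ borel n, toU (p ⊗ₜ[ℂ] b : Cur n) • g
      = algebraMap ℂ (U (Cur n)) (p.eval 0 * wt lam b) • g)
    (hn : ∀ (p : ℂ[X]), ∀ x ∈ nMinus n, toU ((Polynomial.X ^ 2 * p) ⊗ₜ[ℂ] x : Cur n) • g = 0)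
    (ψ : V →ₛₗ[(uMap (truncate n)).toRingHom] Weyl lam) (hψ : ψ g = weylGen lam) :
    ∃ _inst : Module (U (CurA n)) (V ⧸ intKer n V),
      (∀ (u : U (Cur n)) (v : V ⧸ intKer n V), uMap (truncate n) u • v = u • v) ∧
      ∃ Φ : Weyl lam ≃ₗ[U (CurA n)] V ⧸ intKer n V,
        ∀ (u : U (Cur n)) (w : Weyl lam), Φ (uMap (truncate n) u • w) = u • Φ w := by
  set g' : V ⧸ intKer n V := (intKer n V).mkQ g with hg'
  have hspan : Submodule.span (U (Cur n)) {g'} = ⊤ :=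
    span_mkQ_eq_top hg _
  have hb' : ∀ (p : ℂ[X]), ∀ b ∈ borel n, toU (p ⊗ₜ[ℂ] b : Cur n) • g'
      = algebraMap ℂ (U (Cur n)) (p.eval 0 * wt lam b) • g' := fun p b hbm => by
    rw [hg', ← map_smul, hb p b hbm, map_smul]
  have hn' : ∀ (p : ℂ[X]), ∀ x ∈ nMinus n,
      toU ((Polynomial.X ^ 2 * p) ⊗ₜ[ℂ] x : Cur n) • g' = 0 := fun p x hx => by
    rw [hg', ← map_smul, hn p x hx, map_zero]
  have hkill := toU_smul_eq_zero_of_truncate hb' hn'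
  obtain ⟨inst, hinst⟩ := exists_module_of_surjective (V := V ⧸ intKer n V) (truncate n)
    truncate_surjective
    (fun x hx v => toU_smul_eq_zero_of_generator hspan (truncate n) hkill v x hx)
  refine ⟨inst, hinst, ?_⟩
  have hinstU : ∀ (x : Cur n) (v : V ⧸ intKer n V), toU (truncate n x) • v = toU x • v :=
    fun x v => by rw [← uMap_toU, hinst]
  have h1 : ∀ x : Sl n, ((1 : A) ⊗ₜ[ℂ] x : CurA n) = truncate n ((1 : ℂ[X]) ⊗ₜ[ℂ] x) :=
    fun x => by rw [truncate_tmul, map_one]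
  have hrel : weylRel lam ≤ LinearMap.ker (LinearMap.toSpanSingleton (U (CurA n)) _ g') := by
    refine Submodule.span_le.2 ?_
    rintro _ (((⟨x, hx, rfl⟩ | ⟨h, hh, rfl⟩) | ⟨x, hx, rfl⟩) | ⟨i, j, hij, rfl⟩) <;>
      rw [SetLike.mem_coe, LinearMap.mem_ker, LinearMap.toSpanSingleton_apply]
    · rw [tA, ← truncate_tmul, hinstU, hb' _ x hx]
      simp
    · rw [h1, sub_smul, hinstU, hb' _ h (cartan_subset_borel hh),
        ← (uMap (truncate n)).commutes, hinst]
      simp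
    · rw [h1, hinstU, hb' _ x (nPlus_subset_borel hx), wt_of_mem_nPlus lam hx, mul_zero, map_zero,
        zero_smul]
    · rw [h1, ← uMap_toU, ← map_pow, hinst, hg', ← map_smul, Submodule.mkQ_apply,
        Submodule.Quotient.mk_eq_zero]
      exact rootF_pow_smul_mem_intKer hb hij
  let Φ : Weyl lam →ₗ[U (CurA n)] V ⧸ intKer n V := (weylRel lam).liftQ _ hrel
  have hΦ : ∀ u : U (CurA n), Φ ((weylRel lam).mkQ u) = u • g' := fun u => rfl
  let Ψ : (V ⧸ intKer n V) →ₛₗ[(uMap (truncate n)).toRingHom] Weyl lam :=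
    (intKer n V).liftQ ψ (intKer_le_ker hg ψ hψ)
  have hΨ : ∀ u : U (Cur n), Ψ (u • g') = uMap (truncate n) u • weylGen lam := fun u => by
    rw [LinearMap.map_smulₛₗ]
    exact congrArg (fun w => uMap (truncate n) u • w) hψ
  have hbij : Function.Bijective Φ := by
    constructor
    · refine Function.LeftInverse.injective (g := Ψ) fun w => ?_
      obtain ⟨u, rfl⟩ := Submodule.mkQ_surjective _ w
      obtain ⟨u, rfl⟩ := uMap_surjective truncate_surjective u
      rw [hΦ, hinst, hΨ, smul_weylGen]
    · intro v
      have hv : v ∈ Submodule.span (U (Cur n)) {g'} := by rw [hspan]; trivial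
      obtain ⟨u, rfl⟩ := Submodule.mem_span_singleton.1 hv
      exact ⟨(weylRel lam).mkQ (uMap (truncate n) u), by rw [hΦ, hinst]⟩
  refine ⟨LinearEquiv.ofBijective Φ hbij, fun u w => ?_⟩
  rw [map_smul, hinst]

end HighestWeight

/-- The graded local Weyl module is isomorphic to `F` for a maximal pair. -/
theorem exists_weyl_equiv_F {n : ℕ} (l₁ l₂ : DomWeight n)
    (hmax : IsMax (⟨s(l₁, l₂), rfl⟩ : Pairs (l₁ + l₂))) :
    ∃ _inst : Module (U (CurA n)) (F l₁ l₂),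
      (∀ (u : U (Cur n)) (v : F l₁ l₂), uMap (truncate n) u • v = u • v) ∧
      ∃ Φ : Weyl (l₁ + l₂) ≃ₗ[U (CurA n)] F l₁ l₂,
        ∀ (u : U (Cur n)) (w : Weyl (l₁ + l₂)), Φ (uMap (truncate n) u • w) = u • Φ w := by
  have hb : ∀ (p : ℂ[X]), ∀ b ∈ borel n,
      (uMap (truncate n)).toRingHom (toU (p ⊗ₜ[ℂ] b : Cur n)) • weylGen (l₁ + l₂)
        = (uMap (truncate n)).toRingHom (algebraMap ℂ (U (Cur n)) (p.eval 0 * wt (l₁ + l₂) b))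
          • weylGen (l₁ + l₂) := fun p b hb => by
    change uMap (truncate n) _ • _ = uMap (truncate n) _ • _
    rw [uMap_toU, AlgHom.commutes]
    exact borel_smul_weylGen _ p hb
  have hn : ∀ (p : ℂ[X]), ∀ x ∈ nMinus n, (uMap (truncate n)).toRingHom
      (toU ((Polynomial.X ^ 2 * p) ⊗ₜ[ℂ] x : Cur n)) • weylGen (l₁ + l₂) = 0 := fun p x _ => by
    change uMap (truncate n) _ • _ = _
    rw [uMap_toU, truncate_tmul, mk_X_sq_mul, TensorProduct.zero_tmul, toU_zero, zero_smul]
  have hf : ∀ (i j : Fin n) (hij : i < j), (uMap (truncate n)).toRingHom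
      (toU ((Polynomial.X : ℂ[X]) ⊗ₜ[ℂ] rootF hij : Cur n))
        ^ (min (pairing l₁ i j) (pairing l₂ i j) + 1) • weylGen (l₁ + l₂) = 0 := fun i j hij => by
    have h : min (pairing l₁ i j) (pairing l₂ i j) = pairing (l₁ + l₂) i j / 2 :=
      pairMin_of_isMax hmax hij
    rw [h]
    change (uMap (truncate n) _) ^ _ • _ = _
    rw [uMap_toU]
    exact tA_rootF_pow_smul_weylGen _ hij
  refine (exists_lift_indM l₁ l₂ (uMap (truncate n)).toRingHom (weylGen (l₁ + l₂))
    hb hn hf).elim fun ψ hψ => ?_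
  exact exists_weyl_equiv (span_genIndM l₁ l₂) (fun p b hb => borel_smul_genIndM l₁ l₂ p hb)
    (fun p x hx => nMinus_smul_genIndM l₁ l₂ p hx) ψ hψ

end CurrentAlg
end

open CurrentAlg in
theorem mainTheorem4 (n : ℕ) (lam : DomWeight n) :
    (∃! p : Pairs lam, IsMax p) ∧
    ∀ (l₁ l₂ : DomWeight n) (h : l₁ + l₂ = lam), IsMax (⟨s(l₁, l₂), h⟩ : Pairs lam) →
      ∃ _inst : Module (U (CurA n)) (F l₁ l₂),
        (∀ (u : U (Cur n)) (v : F l₁ l₂), uMap (truncate n) u • v = u • v) ∧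
        ∃ Φ : Weyl lam ≃ₗ[U (CurA n)] F l₁ l₂,
          ∀ (u : U (Cur n)) (w : Weyl lam), Φ (uMap (truncate n) u • w) = u • Φ w := by
  refine ⟨existsUnique_isMax lam, ?_⟩
  rintro l₁ l₂ rfl hmax
  exact exists_weyl_equiv_F l₁ l₂ hmax
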